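/- Let $K$ be a field of characteristic $0$ and let $C$ be an elliptic curve over $K$, with function field $K(C)$. By a point of $C$ we mean a closed point; its order is the order of the corresponding $\kappa(x)$-valued point in the group $C(\kappa(x))$, where $\kappa(x)$ is the residue field, and $C\langle n\rangle$ denotes the set of points of exact order $n$ ($n\ge 1$). Give $C$ the torsion point topology, whose non-empty open sets are the complements of finite sets of points of finite order. Consider the following sheaves of rings for this topology: * the structure sheaf $\mathcal O_C$ (functions regular at every point of the open set); * the constant sheaf $\widetilde{\mathcal K}$ on the ring $\mathcal K\subset K(C)$ of meromorphic functions whose poles are all at points of finite order; * for each $n\ge1$ the skyscraper sheaf $\widehat{\mathcal O}_{C\langle n\rangle}$, $U\mapsto\prod_{x\in U\cap C\langle n\rangle}(\mathcal O_{C,x})^{\wedge}$, the completion of $\mathcal O_C$ along $C\langle n\rangle$, and the product $\widehat{\mathcal O}=\prod_{n\ge1}\widehat{\mathcal O}_{C\langle n\rangle}$; * the fork of sheaves of rings $$\mathcal O_C^{\pitchfork}=\Big(\widehat{\mathcal O}\xrightarrow{\ l\ }\widetilde{\mathcal K}\otimes_{\mathcal O_C}\widehat{\mathcal O}\xleftarrow{\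 \iota\ }\widetilde{\mathcal K}\Big).$$ Let $\mathcal A(\mathcal O_C)$ be the category of diagrams $\mathcal N\to\mathcal P\leftarrow\mathcal V$, where $\mathcal N$, $\mathcal P$, $\mathcal V$ are quasi-coherent sheaves of modules over the three sheaves of rings $\widehat{\mathcal O}$, $\widetilde{\mathcal K}\otimes_{\mathcal O_C}\widehat{\mathcal O}$, $\widetilde{\mathcal K}$ respectively, the maps are $\widehat{\mathcal O}$-linear and $\widetilde{\mathcal K}$-linear respectively, and they induce isomorphisms $l_*\mathcal N\cong\mathcal P$ and $\iota_*\mathcal V\cong\mathcal P$, with $l_*,\iota_*$ denoting extension of scalars along $l$ and $\iota$. Morphisms are triples of linear maps making the two squares commute. Let $\mathcal A(C)$ be the category of diagrams of modules $N\to P\leftarrow V$ over the fork of rings obtained by taking global sections, $$\Gamma\mathcal O_C^{\pitchfork}=\Big(\prod_{n}\Gamma\widehat{\mathcal O}_{C\langle n\rangle}\xrightarrow{\ l\ }\Gamma\big(\widetilde{\mathcal K}\otimes_{\mathcal O_C}\widehat{\mathcal O}\big)\xleftarrow{\ \iota\ }\Gamma\widetilde{\mathcal K}\Big),$$ such that the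 two maps again induce isomorphisms $l_*N\cong P$ and $\iota_*V\cong P$. Then the constants give an isomorphism $\mathcal K\cong\Gamma\widetilde{\mathcal K}$, and taking global sections at the three spots of a diagram sends objects of $\mathcal A(\mathcal O_C)$ to objects of $\mathcal A(C)$ and gives an equivalence of categories $$\mathcal A(\mathcal O_C)\simeq\mathcal A(C).$$ -/

import Mathlib

open CategoryTheory Opposite TopologicalSpace

universe u v₁ v₂ v₃ u₁ u₂ u₃

/-! ### Fork-shaped diagrams and extension of scalars -/

section Fork

variable {D₁ : Type u₁} {D₂ : Type u₂} {D₃ : Type u₃}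
  [Category.{v₁} D₁] [Category.{v₂} D₂] [Category.{v₃} D₃]

/-- Diagrams `N ⟶ P ⟵ V`, where `N`, `P`, `V` live in three different categories of modules and
`L`, `R` are the restriction of scalars functors that are needed to make sense of the maps:
`k` is a map `N ⟶ L P` and `m` is a map `V ⟶ R P`. -/
structure ForkDiagram (L : D₂ ⥤ D₁) (R : D₂ ⥤ D₃) where
  N : D₁
  P : D₂
  V : D₃
  k : N ⟶ L.obj P
  m : V ⟶ R.obj P

namespace ForkDiagram

variable {L : D₂ ⥤ D₁} {R : D₂ ⥤ D₃}

/-- Maps of diagrams: three maps making the two squares commute. -/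
@[ext]
structure Hom (X Y : ForkDiagram L R) where
  n : X.N ⟶ Y.N
  p : X.P ⟶ Y.P
  v : X.V ⟶ Y.V
  comm_k : X.k ≫ L.map p = n ≫ Y.k
  comm_m : X.m ≫ R.map p = v ≫ Y.m

instance : Category (ForkDiagram L R) where
  Hom := Hom
  id X := ⟨𝟙 _, 𝟙 _, 𝟙 _, by simp, by simp⟩
  comp f g := ⟨f.n ≫ g.n, f.p ≫ g.p, f.v ≫ g.v,
    by rw [L.map_comp, ← Category.assoc, f.comm_k, Category.assoc, g.comm_k, Category.assoc],
    by rw [R.map_comp, ← Category.assoc, f.comm_m, Category.assoc, g.comm_m, Category.assoc]⟩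
  id_comp f := Hom.ext (Category.id_comp _) (Category.id_comp _) (Category.id_comp _)
  comp_id f := Hom.ext (Category.comp_id _) (Category.comp_id _) (Category.comp_id _)
  assoc f g h := Hom.ext (Category.assoc _ _ _) (Category.assoc _ _ _) (Category.assoc _ _ _)

/-- The diagrams `N ⟶ P ⟵ V` whose two maps induce isomorphisms `l_* N ≅ P` and `ι_* V ≅ P`,
where `l_*`, `ι_*` are the extension of scalars functors, left adjoint to `L` and `R`. -/
def isExtended {El : D₁ ⥤ D₂} {Er : D₃ ⥤ D₂} (adjL : El ⊣ L) (adjR : Er ⊣ R) :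
    ObjectProperty (ForkDiagram L R) := fun X =>
  IsIso ((adjL.homEquiv X.N X.P).symm X.k) ∧ IsIso ((adjR.homEquiv X.V X.P).symm X.m)

end ForkDiagram

end Fork

/-! ### Sheaves of functions -/

section FunctionSheaf

/-- Given a family of rings `T i` attached to points `π i` of a space `X`, the sheaf of rings whose
sections over `U` are the families `(s i)` indexed by the `i` with `π i ∈ U` that satisfy a local
condition `S`. -/
def functionSheaf {X : TopCat.{u}} {I : Type u} (π : I → X) (T : I → Type u)
    [∀ i, CommRing (T i)] (S : ∀ U : Opens X, Subring (∀ i : {i // π i ∈ U}, T i))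
    (hres : ∀ (U V : Opens X) (h : V ≤ U), ∀ s ∈ S U,
      (fun i : {i // π i ∈ V} => s ⟨i, h i.2⟩) ∈ S V)
    (hloc : ∀ (U : Opens X) (s : ∀ i : {i // π i ∈ U}, T i),
      (∀ x ∈ U, ∃ (V : Opens X) (h : V ≤ U), x ∈ V ∧
        (fun i : {i // π i ∈ V} => s ⟨i, h i.2⟩) ∈ S V) → s ∈ S U) :
    Sheaf (Opens.grothendieckTopology X) CommRingCat.{u} where
  obj :=
    { obj := fun U => CommRingCat.of (S U.unop)
      map := fun {U V} f => CommRingCat.ofHom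
        { toFun := fun s => ⟨fun i => s.1 ⟨i, leOfHom f.unop i.2⟩,
            hres _ _ (leOfHom f.unop) s.1 s.2⟩
          map_one' := rfl
          map_mul' := fun _ _ => rfl
          map_zero' := rfl
          map_add' := fun _ _ => rfl }
      map_id := fun _ => rfl
      map_comp := fun _ _ => rfl }
  property := by
    refine (TopCat.Presheaf.isSheaf_iff_isSheafUniqueGluing _).mpr ?_
    intro ι U sf hsf
    change ∀ j, S (U j) at sf
    have key : ∀ (j j' : ι) (i : I) (h : π i ∈ U j) (h' : π i ∈ U j'),
        (sf j).1 ⟨i, h⟩ = (sf j').1 ⟨i, h'⟩ := fun j j' i h h' =>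
      congrFun (congrArg Subtype.val (hsf j j')) ⟨i, h, h'⟩
    have hex : ∀ i : {i // π i ∈ iSup U}, ∃ j, π i ∈ U j := fun i => Opens.mem_iSup.mp i.2
    choose c hc using hex
    let s : ∀ i : {i // π i ∈ iSup U}, T i := fun i => (sf (c i)).1 ⟨i, hc i⟩
    have hs : ∀ j (i : {i // π i ∈ U j}), s ⟨i, le_iSup U j i.2⟩ = (sf j).1 i :=
      fun j i => key _ _ _ _ _
    refine ⟨⟨s, hloc _ s fun x hx => ?_⟩, fun j => Subtype.ext (funext (hs j)), ?_⟩
    · obtain ⟨j, hj⟩ := Opens.mem_iSup.mp hx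
      refine ⟨U j, le_iSup U j, hj, ?_⟩
      have : (fun i : {i // π i ∈ U j} => s ⟨i, le_iSup U j i.2⟩) = (sf j).1 := funext (hs j)
      rw [this]
      exact (sf j).2
    · intro t ht
      refine Subtype.ext (funext fun i => ?_)
      exact congrFun (congrArg Subtype.val (ht (c i))) ⟨i, hc i⟩

/-- The product of a family of sheaves of rings, computed on sections. -/
def piSheaf {X : TopCat.{u}} {J : Type}
    (G : J → Sheaf (Opens.grothendieckTopology X) CommRingCat.{u}) :
    Sheaf (Opens.grothendieckTopology X) CommRingCat.{u} where
  obj :=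
    { obj := fun U => CommRingCat.of (∀ j, (G j).obj.obj U)
      map := fun f => CommRingCat.ofHom (RingHom.pi fun j =>
        ((G j).obj.map f).hom.comp (Pi.evalRingHom _ j))
      map_id := fun U => by ext s j; simp
      map_comp := fun f g => by ext s j; simp }
  property := by
    refine (TopCat.Presheaf.isSheaf_iff_isSheafUniqueGluing _).mpr ?_
    intro ι U sf hsf
    have h : ∀ j, ∃! s, TopCat.Presheaf.IsGluing (G j).obj U (fun i => sf i j) s := fun j =>
      (TopCat.Presheaf.isSheaf_iff_isSheafUniqueGluing _).mp (G j).property U (fun i => sf i j)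
        fun i i' => congrFun (hsf i i') j
    choose s hs hs' using h
    exact ⟨s, fun i => funext fun j => hs j i,
      fun t ht => funext fun j => hs' j (t j) fun i => congrFun (ht i) j⟩

/-- A function on an open set is locally constant. -/
def IsLocConst {X : TopCat.{u}} {U : Opens X} {A : Type u} (s : {x : X // x ∈ U} → A) : Prop :=
  ∀ x : {x : X // x ∈ U}, ∃ V : Opens X, x.1 ∈ V ∧ ∀ y : {x : X // x ∈ U}, y.1 ∈ V → s y = s x

lemma isLocConst_const {X : TopCat.{u}} {U : Opens X} {A : Type u} (a : A) :
    IsLocConst (fun _ : {x : X // x ∈ U} => a) := fun x => ⟨U, x.2, fun _ _ => rfl⟩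

lemma IsLocConst.comp {X : TopCat.{u}} {U : Opens X} {A B : Type u} {s : {x : X // x ∈ U} → A}
    (hs : IsLocConst s) (f : A → B) : IsLocConst (fun x => f (s x)) := fun x =>
  let ⟨V, hV, h⟩ := hs x
  ⟨V, hV, fun y hy => congrArg f (h y hy)⟩

lemma IsLocConst.comp₂ {X : TopCat.{u}} {U : Opens X} {A B D : Type u}
    {s : {x : X // x ∈ U} → A} {t : {x : X // x ∈ U} → B} (hs : IsLocConst s) (ht : IsLocConst t)
    (f : A → B → D) : IsLocConst (fun x => f (s x) (t x)) := fun x =>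
  let ⟨V, hV, h⟩ := hs x
  let ⟨V', hV', h'⟩ := ht x
  ⟨V ⊓ V', ⟨hV, hV'⟩, fun y hy => congrArg₂ f (h y hy.1) (h' y hy.2)⟩

lemma IsLocConst.res {X : TopCat.{u}} {U V : Opens X} {A : Type u} {s : {x : X // x ∈ U} → A}
    (hs : IsLocConst s) (h : V ≤ U) :
    IsLocConst (fun x : {x : X // x ∈ V} => s ⟨x, h x.2⟩) := fun x =>
  let ⟨V', hV', h'⟩ := hs ⟨x, h x.2⟩
  ⟨V', hV', fun _ hy => h' _ hy⟩

lemma isLocConst_of_locally {X : TopCat.{u}} {U : Opens X} {A : Type u}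
    {s : {x : X // x ∈ U} → A} (hs : ∀ x ∈ U, ∃ (V : Opens X) (h : V ≤ U), x ∈ V ∧
      IsLocConst (fun y : {x : X // x ∈ V} => s ⟨y, h y.2⟩)) : IsLocConst s := fun x =>
  let ⟨V, _, hx, h⟩ := hs x x.2
  let ⟨V', hV', h'⟩ := h ⟨x, hx⟩
  ⟨V ⊓ V', ⟨hx, hV'⟩, fun y hy => h' ⟨y, hy.1⟩ hy.2⟩

/-- The constant sheaf with value a ring `A`: locally constant functions to `A`. -/
def constSheaf (X : TopCat.{u}) (A : Type u) [CommRing A] :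
    Sheaf (Opens.grothendieckTopology X) CommRingCat.{u} :=
  functionSheaf (X := X) (fun x => x) (fun _ => A)
    (fun _ =>
      { carrier := {s | IsLocConst s}
        zero_mem' := isLocConst_const 0
        one_mem' := isLocConst_const 1
        add_mem' := fun hs ht => hs.comp₂ ht (· + ·)
        mul_mem' := fun hs ht => hs.comp₂ ht (· * ·)
        neg_mem' := fun hs => hs.comp (- ·) })
    (fun _ _ h _ hs => IsLocConst.res hs h)
    (fun _ _ hs => isLocConst_of_locally hs)

/-- The constants, as global sections of the constant sheaf. -/
def constSection (X : TopCat.{u}) (A : Type u) [CommRing A] :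
    A →+* (constSheaf X A).obj.obj (op ⊤) where
  toFun a := ⟨fun _ => a, isLocConst_const a⟩
  map_one' := rfl
  map_mul' := fun _ _ => rfl
  map_zero' := rfl
  map_add' := fun _ _ => rfl

end FunctionSheaf

/-! ### The curve, its points of finite order and its local rings -/

namespace TorsionCurve

noncomputable section

variable {k : Type u} [Field k] (W : WeierstrassCurve k)

/-- The affine coordinate ring `k[x, y]` of the curve minus its point at infinity. -/
abbrev CoordRing : Type u := W.toAffine.CoordinateRing

/-- The function field of the curve. -/
abbrev FunField : Type u := W.toAffine.FunctionField

/-- The coordinate function `x`. -/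
def xCoord : CoordRing W := WeierstrassCurve.Affine.CoordinateRing.mk _ (Polynomial.C Polynomial.X)

/-- The coordinate function `y`. -/
def yCoord : CoordRing W := WeierstrassCurve.Affine.CoordinateRing.mk _ Polynomial.X

/-- The (closed) points of the projective curve: the point at infinity `none`, which is the
identity of the group, and the maximal ideals of the affine coordinate ring. -/
def Pt : Type u := Option (MaximalSpectrum (CoordRing W))

lemma equation_residue (m : MaximalSpectrum (CoordRing W)) :
    (W.baseChange m.asIdeal.ResidueField).toAffine.Equation
      (algebraMap _ m.asIdeal.ResidueField (xCoord W))
      (algebraMap _ m.asIdeal.ResidueField (yCoord W)) := by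
  have h : yCoord W ^ 2 + algebraMap k _ W.a₁ * xCoord W * yCoord W
      + algebraMap k _ W.a₃ * yCoord W = xCoord W ^ 3 + algebraMap k _ W.a₂ * xCoord W ^ 2
      + algebraMap k _ W.a₄ * xCoord W + algebraMap k _ W.a₆ := by
    have h0 : WeierstrassCurve.Affine.CoordinateRing.mk W.toAffine
        W.toAffine.polynomial = 0 := AdjoinRoot.mk_self
    have hc (a : k) : algebraMap k (CoordRing W) a =
      WeierstrassCurve.Affine.CoordinateRing.mk W.toAffine (Polynomial.C (Polynomial.C a)) := rfl
    simp only [WeierstrassCurve.Affine.polynomial, map_add, map_sub, map_mul, map_pow] at h0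
    simp only [hc, xCoord, yCoord]
    linear_combination h0
  rw [WeierstrassCurve.Affine.equation_iff]
  have h' := congrArg (algebraMap (CoordRing W) m.asIdeal.ResidueField) h
  simp only [map_add, map_mul, map_pow, ← IsScalarTower.algebraMap_apply] at h'
  exact h'

/-- The tautological point, with coordinates in the residue field, at a maximal ideal of the
coordinate ring. -/
def tautologicalPoint [W.IsElliptic] (m : MaximalSpectrum (CoordRing W)) :
    (W.baseChange m.asIdeal.ResidueField).toAffine.Point :=
  .some (algebraMap _ m.asIdeal.ResidueField (xCoord W))
    (algebraMap _ m.asIdeal.ResidueField (yCoord W))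
    (haveI : WeierstrassCurve.IsElliptic (W.baseChange m.asIdeal.ResidueField).toAffine :=
        inferInstanceAs (W.map (algebraMap k m.asIdeal.ResidueField)).IsElliptic;
      WeierstrassCurve.Affine.equation_iff_nonsingular.mp (equation_residue W m))

open Classical in
/-- The exact order of a point, as an element of the group of points of the curve over the residue
field; the value is `0` if the point is not of finite order. -/
def order [W.IsElliptic] : Pt W → ℕ
  | none => 1
  | some m => addOrderOf (tautologicalPoint W m)

/-- The points of finite order. -/
def IsTorsion [W.IsElliptic] (x : Pt W) : Prop := order W x ≠ 0

/-- A form `q` in the homogeneous coordinates vanishes at the point `x` (which is `[0 : 1 : 0]` for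
the point at infinity, and `[x : y : 1]` modulo the maximal ideal otherwise). -/
def VanishesAt : Pt W → MvPolynomial (Fin 3) k → Prop
  | none, q => MvPolynomial.eval ![0, 1, 0] q = 0
  | some m, q => MvPolynomial.aeval ![xCoord W, yCoord W, 1] q ∈ m.asIdeal

lemma vanishesAt_zero (x : Pt W) : VanishesAt W x 0 := by
  cases x <;> simp [VanishesAt]

lemma vanishesAt_add {x : Pt W} {p q : MvPolynomial (Fin 3) k} (hp : VanishesAt W x p)
    (hq : VanishesAt W x q) : VanishesAt W x (p + q) := by
  cases x with
  | none => simp_all [VanishesAt]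
  | some m =>
    simp only [VanishesAt, map_add] at *
    exact add_mem hp hq

lemma vanishesAt_mul {x : Pt W} {p q : MvPolynomial (Fin 3) k} :
    VanishesAt W x (p * q) ↔ VanishesAt W x p ∨ VanishesAt W x q := by
  cases x with
  | none => simp [VanishesAt]
  | some m =>
    simp only [VanishesAt, map_mul]
    exact m.isMaximal.isPrime.mul_mem_iff_mem_or_mem

lemma not_vanishesAt_one (x : Pt W) : ¬ VanishesAt W x 1 := by
  cases x with
  | none => simp [VanishesAt]
  | some m =>
    simp only [VanishesAt, map_one]
    exact fun h => m.isMaximal.ne_top ((Ideal.eq_top_iff_one _).mpr h)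

/-- The function on the curve given by a polynomial in the homogeneous coordinates, after
dehomogenising by `Z = 1`. -/
def formValue : MvPolynomial (Fin 3) k →ₐ[k] FunField W :=
  MvPolynomial.aeval ![algebraMap _ _ (xCoord W), algebraMap _ _ (yCoord W), 1]

/-- `f = p / q` with `p` and `q` forms of the same degree and `q` not vanishing at `x`. -/
def IsFractionAt (x : Pt W) (f : FunField W) (p q : MvPolynomial (Fin 3) k) : Prop :=
  (∃ d : ℕ, p.IsHomogeneous d ∧ q.IsHomogeneous d) ∧ ¬ VanishesAt W x q ∧
    formValue W q ≠ 0 ∧ f = formValue W p / formValue W q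

lemma isFractionAt_zero (x : Pt W) : IsFractionAt W x 0 0 1 :=
  ⟨⟨0, MvPolynomial.isHomogeneous_zero _ _ _, MvPolynomial.isHomogeneous_one _ _⟩,
    not_vanishesAt_one W x, by simp, by simp⟩

lemma isFractionAt_one (x : Pt W) : IsFractionAt W x 1 1 1 :=
  ⟨⟨0, MvPolynomial.isHomogeneous_one _ _, MvPolynomial.isHomogeneous_one _ _⟩,
    not_vanishesAt_one W x, by simp, by simp⟩

lemma IsFractionAt.neg {W : WeierstrassCurve k} {x : Pt W} {f : FunField W}
    {p q : MvPolynomial (Fin 3) k} (h : IsFractionAt W x f p q) :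
    IsFractionAt W x (-f) (-p) q := by
  obtain ⟨⟨d, hp, hq⟩, h1, h2, rfl⟩ := h
  exact ⟨⟨d, hp.neg, hq⟩, h1, h2, by rw [map_neg, neg_div]⟩

lemma IsFractionAt.mul {W : WeierstrassCurve k} {x : Pt W} {f f' : FunField W}
    {p q p' q' : MvPolynomial (Fin 3) k} (h : IsFractionAt W x f p q)
    (h' : IsFractionAt W x f' p' q') : IsFractionAt W x (f * f') (p * p') (q * q') := by
  obtain ⟨⟨d, hp, hq⟩, h1, h2, rfl⟩ := h
  obtain ⟨⟨d', hp', hq'⟩, h1', h2', rfl⟩ := h'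
  refine ⟨⟨d + d', hp.mul hp', hq.mul hq'⟩, ?_, ?_, ?_⟩
  · rw [vanishesAt_mul]; tauto
  · rw [map_mul]; exact mul_ne_zero h2 h2'
  · rw [map_mul, map_mul, div_mul_div_comm]

lemma IsFractionAt.add {W : WeierstrassCurve k} {x : Pt W} {f f' : FunField W}
    {p q p' q' : MvPolynomial (Fin 3) k} (h : IsFractionAt W x f p q)
    (h' : IsFractionAt W x f' p' q') :
    IsFractionAt W x (f + f') (p * q' + q * p') (q * q') := by
  obtain ⟨⟨d, hp, hq⟩, h1, h2, rfl⟩ := h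
  obtain ⟨⟨d', hp', hq'⟩, h1', h2', rfl⟩ := h'
  refine ⟨⟨d + d', (hp.mul hq').add (hq.mul hp'), hq.mul hq'⟩, ?_, ?_, ?_⟩
  · rw [vanishesAt_mul]; tauto
  · rw [map_mul]; exact mul_ne_zero h2 h2'
  · rw [map_mul, map_add, map_mul, map_mul, div_add_div _ _ h2 h2']

/-- The local ring `𝒪_{C,x}` of functions regular at `x`. -/
def localRing (x : Pt W) : Subring (FunField W) where
  carrier := {f | ∃ p q, IsFractionAt W x f p q}
  zero_mem' := ⟨_, _, isFractionAt_zero W x⟩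
  one_mem' := ⟨_, _, isFractionAt_one W x⟩
  add_mem' := fun ⟨_, _, h⟩ ⟨_, _, h'⟩ => ⟨_, _, h.add h'⟩
  mul_mem' := fun ⟨_, _, h⟩ ⟨_, _, h'⟩ => ⟨_, _, h.mul h'⟩
  neg_mem' := fun ⟨_, _, h⟩ => ⟨_, _, h.neg⟩

/-- The ideal of the functions in `𝒪_{C,x}` that vanish at `x`. -/
def maxIdeal (x : Pt W) : Ideal (localRing W x) where
  carrier := {f | ∃ p q, IsFractionAt W x f p q ∧ VanishesAt W x p}
  zero_mem' := ⟨_, _, isFractionAt_zero W x, vanishesAt_zero W x⟩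
  add_mem' := fun ⟨_, _, h, hp⟩ ⟨_, _, h', hp'⟩ => ⟨_, _, h.add h',
    vanishesAt_add W ((vanishesAt_mul W).mpr (Or.inl hp)) ((vanishesAt_mul W).mpr (Or.inr hp'))⟩
  smul_mem' := fun ⟨_, _, _, h⟩ _ ⟨_, _, h', hp'⟩ => ⟨_, _, h.mul h',
    (vanishesAt_mul W).mpr (Or.inr hp')⟩

/-- The completed local ring `(𝒪_C)_x^∧`. -/
abbrev completedLocalRing (x : Pt W) : Type u := AdicCompletion (maxIdeal W x) (localRing W x)

variable [W.IsElliptic]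

/-- The ring `𝒦` of meromorphic functions with poles only at points of finite order. -/
def meromorphic : Subring (FunField W) := ⨅ x : {x : Pt W // ¬ IsTorsion W x}, localRing W x

/-- The torsion point topology: the non-empty open sets are the complements of finite sets of
points of finite order. -/
instance torsionPointTopology : TopologicalSpace (Pt W) where
  IsOpen U := U = ∅ ∨ (Uᶜ.Finite ∧ ∀ x ∈ Uᶜ, IsTorsion W x)
  isOpen_univ := by right; simp
  isOpen_inter := by
    rintro s t (rfl | ⟨hs, hs'⟩) (rfl | ⟨ht, ht'⟩)
    · simp
    · simp
    · simp
    · right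
      rw [Set.compl_inter]
      refine ⟨hs.union ht, ?_⟩
      rintro x (hx | hx)
      · exact hs' x hx
      · exact ht' x hx
  isOpen_sUnion := by
    intro S hS
    by_cases h : ∀ s ∈ S, s = ∅
    · left
      exact Set.sUnion_eq_empty.mpr h
    · right
      push Not at h
      obtain ⟨s, hsS, hs⟩ := h
      have hsub : (⋃₀ S)ᶜ ⊆ sᶜ := Set.compl_subset_compl.mpr (Set.subset_sUnion_of_mem hsS)
      rcases hS s hsS with h | ⟨h, h'⟩
      · exact absurd h hs.ne_empty
      · exact ⟨h.subset hsub, fun x hx => h' x (hsub hx)⟩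

/-- The curve with the torsion point topology. -/
def Ctp : TopCat.{u} := TopCat.of (Pt W)

/-- The site of open sets. -/
abbrev tp : GrothendieckTopology (Opens (Ctp W)) := Opens.grothendieckTopology (Ctp W)

/-- The structure sheaf `𝒪_C` on the torsion point topology. -/
def structureSheaf : Sheaf (tp W) CommRingCat.{u} :=
  functionSheaf (X := Ctp W) (fun x => x) (fun _ => FunField W)
    (fun _ =>
      { carrier := {s | IsLocConst s ∧ ∀ x, s x ∈ localRing W x.1}
        zero_mem' := ⟨isLocConst_const 0, fun _ => zero_mem _⟩
        one_mem' := ⟨isLocConst_const 1, fun _ => one_mem _⟩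
        add_mem' := fun hs ht => ⟨hs.1.comp₂ ht.1 (· + ·), fun x => add_mem (hs.2 x) (ht.2 x)⟩
        mul_mem' := fun hs ht => ⟨hs.1.comp₂ ht.1 (· * ·), fun x => mul_mem (hs.2 x) (ht.2 x)⟩
        neg_mem' := fun hs => ⟨hs.1.comp (- ·), fun x => neg_mem (hs.2 x)⟩ })
    (fun _ _ h _ hs => ⟨hs.1.res h, fun x => hs.2 ⟨x, h x.2⟩⟩)
    (fun _ _ hs => ⟨isLocConst_of_locally fun x hx =>
        let ⟨V, h, hV, h'⟩ := hs x hx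
        ⟨V, h, hV, h'.1⟩,
      fun x =>
        let ⟨_, _, hV, h'⟩ := hs x x.2
        h'.2 ⟨x, hV⟩⟩)

/-- The constant sheaf of meromorphic functions with poles only at points of finite order. -/
def meromorphicSheaf : Sheaf (tp W) CommRingCat.{u} := constSheaf (Ctp W) (meromorphic W)

/-- The points `C⟨n⟩` of exact order `n`. -/
abbrev ExactOrder (n : ℕ+) : Type u := {x : Pt W // order W x = n}

/-- The completion of `𝒪_C` along `C⟨n⟩`: the skyscraper sheaf, concentrated on the points of exact
order `n`, of the completed local rings. -/
def completionAt (n : ℕ+) : Sheaf (tp W) CommRingCat.{u} :=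
  functionSheaf (X := Ctp W) (I := ExactOrder W n) (fun x => x.1)
    (fun x => completedLocalRing W x.1) (fun _ => ⊤) (fun _ _ _ _ _ => trivial)
    (fun _ _ _ => trivial)

/-- The sheaf `∏ₙ 𝒪_{C⟨n⟩}^∧`. -/
def completionSheaf : Sheaf (tp W) CommRingCat.{u} := piSheaf (completionAt W)

lemma mem_of_isOpen_of_not_isTorsion {U : Opens (Ctp W)} {x y : Pt W} (hx : x ∈ U)
    (hy : ¬ IsTorsion W y) : y ∈ U := by
  rcases U.isOpen with h | ⟨_, h⟩
  · have hx' : x ∈ U.carrier := hx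
    rw [show U.carrier = ∅ from h] at hx'
    exact hx'.elim
  · by_contra hyU
    exact hy (h y hyU)

lemma mem_meromorphic {U : Opens (Ctp W)} {s : {x : Ctp W // x ∈ U} → FunField W}
    (hs : IsLocConst s) (hs' : ∀ x, s x ∈ localRing W x.1) (x : {x : Ctp W // x ∈ U}) :
    s x ∈ meromorphic W := by
  rw [meromorphic, Subring.mem_iInf]
  rintro ⟨y, hy⟩
  obtain ⟨V, hV, h⟩ := hs x
  have hyU : y ∈ U := mem_of_isOpen_of_not_isTorsion W x.2 hy
  rw [← h ⟨y, hyU⟩ (mem_of_isOpen_of_not_isTorsion W hV hy)]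
  exact hs' ⟨y, hyU⟩

/-- The inclusion of the regular functions in the meromorphic functions. -/
def toMeromorphic : structureSheaf W ⟶ meromorphicSheaf W where
  hom :=
    { app := fun _ => CommRingCat.ofHom
        { toFun := fun s => ⟨fun x => ⟨s.1 x, mem_meromorphic W s.2.1 s.2.2 x⟩, fun x =>
            let ⟨V, hV, h⟩ := s.2.1 x
            ⟨V, hV, fun y hy => Subtype.ext (h y hy)⟩⟩
          map_one' := rfl
          map_mul' := fun _ _ => rfl
          map_zero' := rfl
          map_add' := fun _ _ => rfl }
      naturality := fun _ _ _ => rfl }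

/-- The completion map, sending a regular function to the family of its images in the completed
local rings. -/
def toCompletion : structureSheaf W ⟶ completionSheaf W where
  hom :=
    { app := fun _ => CommRingCat.ofHom (RingHom.pi fun n =>
        { toFun := fun s => ⟨fun x => algebraMap (localRing W x.1.1) (completedLocalRing W x.1.1)
            ⟨s.1 ⟨x.1.1, x.2⟩, s.2.2 ⟨x.1.1, x.2⟩⟩, trivial⟩
          map_one' := Subtype.ext (funext fun _ => map_one _)
          map_mul' := fun _ _ => Subtype.ext (funext fun x =>
            map_mul (algebraMap (localRing W x.1.1) (completedLocalRing W x.1.1)) ⟨_, _⟩ ⟨_, _⟩)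
          map_zero' := Subtype.ext (funext fun _ => map_zero _)
          map_add' := fun _ _ => Subtype.ext (funext fun x =>
            map_add (algebraMap (localRing W x.1.1) (completedLocalRing W x.1.1)) ⟨_, _⟩ ⟨_, _⟩) })
      naturality := fun _ _ _ => rfl }

/-- The sheaf of rings `𝒦 ⊗_{𝒪_C} ∏ₙ 𝒪_{C⟨n⟩}^∧`: the tensor product of sheaves of commutative
rings is their pushout. -/
def tensorSheaf : Sheaf (tp W) CommRingCat.{u} :=
  Limits.pushout (toCompletion W) (toMeromorphic W)

/-- The map `l : ∏ₙ 𝒪_{C⟨n⟩}^∧ ⟶ 𝒦 ⊗ ∏ₙ 𝒪_{C⟨n⟩}^∧` of the fork. -/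
def forkL : completionSheaf W ⟶ tensorSheaf W := Limits.pushout.inl _ _

/-- The map `ι : 𝒦 ⟶ 𝒦 ⊗ ∏ₙ 𝒪_{C⟨n⟩}^∧` of the fork. -/
def forkI : meromorphicSheaf W ⟶ tensorSheaf W := Limits.pushout.inr _ _

end

end TorsionCurve

/-! ### Modules over the fork of sheaves and over the fork of rings of global sections -/

namespace TorsionCurve

noncomputable section

section Modules

variable {X : TopCat.{u}} {A B : Sheaf (Opens.grothendieckTopology X) CommRingCat.{u}}

/-- A sheaf of commutative rings as a sheaf of rings. -/
abbrev ringSheaf (A : Sheaf (Opens.grothendieckTopology X) CommRingCat.{u}) :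
    Sheaf (Opens.grothendieckTopology X) RingCat.{u} :=
  (sheafCompose _ (forget₂ CommRingCat.{u} RingCat.{u})).obj A

/-- The map of sheaves of rings underlying a map of sheaves of commutative rings. -/
abbrev ringSheafMap (f : A ⟶ B) : ringSheaf A ⟶ ringSheaf B :=
  (sheafCompose _ (forget₂ CommRingCat.{u} RingCat.{u})).map f

/-- Sheaves of modules over a sheaf of commutative rings. -/
abbrev ShMod (A : Sheaf (Opens.grothendieckTopology X) CommRingCat.{u}) : Type (u + 1) :=
  SheafOfModules.{u} (ringSheaf A)

/-- Restriction of scalars of sheaves of modules. -/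
abbrev shRestrict (f : A ⟶ B) : ShMod B ⥤ ShMod A :=
  SheafOfModules.restrictScalars.{u} (ringSheafMap f)

instance shRestrict_isRightAdjoint (f : A ⟶ B) : (SheafOfModules.pushforward.{u} (F := 𝟭 (Opens X)) (S := ringSheaf A)
    (R := ringSheaf B) (ringSheafMap f)).IsRightAdjoint := by
  have : (PresheafOfModules.pushforward.{u} (F := 𝟭 (Opens X)) (S := (ringSheaf A).obj)
    (R := (ringSheaf B).obj) (ringSheafMap f).hom).IsRightAdjoint := inferInstance
  exact (SheafOfModules.PullbackConstruction.adjunction.{u} (F := 𝟭 (Opens X)) (S := ringSheaf A)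
    (R := ringSheaf B) (ringSheafMap f)).isRightAdjoint

/-- Extension of scalars of sheaves of modules. -/
def shExtend (f : A ⟶ B) : ShMod A ⥤ ShMod B :=
  SheafOfModules.pullback.{u} (F := 𝟭 (Opens X)) (S := ringSheaf A) (R := ringSheaf B)
    (ringSheafMap f)

/-- Extension of scalars is left adjoint to restriction of scalars. -/
def shAdj (f : A ⟶ B) : shExtend f ⊣ shRestrict f :=
  SheafOfModules.pullbackPushforwardAdjunction.{u} (F := 𝟭 (Opens X)) (S := ringSheaf A)
    (R := ringSheaf B) (ringSheafMap f)

/-- The commutative ring of global sections. -/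
abbrev Γ (A : Sheaf (Opens.grothendieckTopology X) CommRingCat.{u}) : Type u := A.obj.obj (op ⊤)

/-- The ring homomorphism on global sections. -/
abbrev Γmap (f : A ⟶ B) : Γ A →+* Γ B := (f.hom.app (op ⊤)).hom

/-- The module of global sections of a sheaf of modules. -/
def ΓMod (A : Sheaf (Opens.grothendieckTopology X) CommRingCat.{u}) :
    ShMod A ⥤ ModuleCat.{u} (Γ A) :=
  SheafOfModules.evaluation.{u} (ringSheaf A) (op ⊤)

end Modules

variable {k : Type u} [Field k] (W : WeierstrassCurve k) [W.IsElliptic]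

/-- Diagrams `N ⟶ P ⟵ V` of sheaves of modules over the fork of sheaves of rings. -/
abbrev SheafFork : Type (u + 1) := ForkDiagram (shRestrict (forkL W)) (shRestrict (forkI W))

/-- Diagrams `N ⟶ P ⟵ V` of modules over the fork of rings of global sections. -/
abbrev ModuleFork : Type (u + 1) :=
  ForkDiagram (ModuleCat.restrictScalars.{u} (Γmap (forkL W)))
    (ModuleCat.restrictScalars.{u} (Γmap (forkI W)))

/-- The objects of `𝒜(𝒪_C)`: diagrams of quasi-coherent sheaves of modules over the fork whose maps
induce isomorphisms from the extensions of scalars. -/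
def isAOC : ObjectProperty (SheafFork W) := fun X =>
  (X.N.IsQuasicoherent ∧ X.P.IsQuasicoherent ∧ X.V.IsQuasicoherent) ∧
    ForkDiagram.isExtended (shAdj (forkL W)) (shAdj (forkI W)) X

/-- The objects of `𝒜(C)`: diagrams of modules over the fork of rings of global sections whose maps
induce isomorphisms from the extensions of scalars. -/
def isAC : ObjectProperty (ModuleFork W) :=
  ForkDiagram.isExtended (ModuleCat.extendRestrictScalarsAdj.{u} (Γmap (forkL W)))
    (ModuleCat.extendRestrictScalarsAdj.{u} (Γmap (forkI W)))

/-- Global sections, taken at the three spots of a diagram. -/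
def globalSections : SheafFork W ⥤ ModuleFork W where
  obj X :=
    { N := (ΓMod _).obj X.N
      P := (ΓMod _).obj X.P
      V := (ΓMod _).obj X.V
      k := (ΓMod _).map X.k
      m := (ΓMod _).map X.m }
  map f :=
    { n := (ΓMod _).map f.n
      p := (ΓMod _).map f.p
      v := (ΓMod _).map f.v
      comm_k := congrArg (fun g => (ΓMod (completionSheaf W)).map g) f.comm_k
      comm_m := congrArg (fun g => (ΓMod (meromorphicSheaf W)).map g) f.comm_m }
  map_id _ := rfl
  map_comp _ _ := rfl

end

end TorsionCurve

/-! All three sheaves of rings of the fork are split: for every open set $U$, restriction from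
global functions to $U$ is surjective, with kernel generated by an idempotent $e_U$ (`IsSplit`).
Over a split sheaf $A$ on a Noetherian space, a module $M$ over $\Gamma A$ gives a sheaf $U \mapsto
M / I_U M$ without sheafification, $I_U$ being the ideal of functions vanishing on $U$ (`tilde`).
The quasi-coherent sheaves are exactly those of this form (`IsSplit.isQuasicoherent_iff`), and for
such $F$ and arbitrary $H$, maps $F \to H$ are the same as maps of global sections
(`IsSplit.isCoreflection_ΓMod`).

This transfers to diagrams one spot at a time. The target of a structure map is a restriction of
scalars which is not known to be quasi-coherent; this is harmless because a coreflection constrains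
only the source. That $l_*\mathcal N \to \mathcal P$ is an isomorphism says that $\mathcal N \to
\mathcal P$ is a universal arrow, which can be tested on global sections
(`isIso_homEquiv_symm_iff_of_isCoreflection`).

It remains to prove splitness. In characteristic $0$ there are infinitely many points, so non-empty
open sets meet and constant sheaves are constant on each of them; the completion is a product over
points. The tensor product is the hard case, because sections of $\mathcal O_C$ over $U$ need not
extend. By `isSplit_pushout` it suffices that, whenever a sheaf of rings receives compatible maps
from both factors, the idempotent $1 - e_U$ of the completion kills the difference between a
meromorphic function regular on $U$ and a family of expansions agreeing with it on $U$. This is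
checked on two open sets covering $C$, the complements of the point at infinity and of the points of
order two. There $1 - e_U$ is a finite combination of denominators $g$ for which $g$ and $gf$ are
both regular (`exists_denominators`, `resTop_gen_mul_sub_eq_zero`). -/

/-! ### Coreflective object properties -/

section Coreflective

universe v₄ u₄ v u'

variable {𝒜 : Type u₁} [Category.{v₁} 𝒜] {ℬ : Type u₂} [Category.{v₂} ℬ]

/-- The objects with property `P` form a full subcategory of `𝒜` which the functor `G` identifies
with `ℬ`, in such a way that `G` becomes the coreflection. -/
structure IsCoreflection (G : 𝒜 ⥤ ℬ) (P : ObjectProperty 𝒜) : Prop where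
  bijective {F : 𝒜} (hF : P F) (H : 𝒜) : Function.Bijective (G.map : (F ⟶ H) → _)
  exists_iso (M : ℬ) : ∃ F, P F ∧ Nonempty (G.obj F ≅ M)

namespace IsCoreflection

variable {G : 𝒜 ⥤ ℬ} {P : ObjectProperty 𝒜}

/-- The maps out of an object with property `P`. -/
noncomputable def homEquiv (h : IsCoreflection G P) {F : 𝒜} (hF : P F) (H : 𝒜) :
    (F ⟶ H) ≃ (G.obj F ⟶ G.obj H) :=
  Equiv.ofBijective _ (h.bijective hF H)

@[simp]
lemma map_homEquiv_symm (h : IsCoreflection G P) {F : 𝒜} (hF : P F) {H : 𝒜}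
    (g : G.obj F ⟶ G.obj H) : G.map ((h.homEquiv hF H).symm g) = g :=
  (h.homEquiv hF H).apply_symm_apply g

lemma hom_ext (h : IsCoreflection G P) {F : 𝒜} (hF : P F) {H : 𝒜} {f g : F ⟶ H}
    (hfg : G.map f = G.map g) : f = g :=
  (h.bijective hF H).1 hfg

/-- Form the colimit of the images in `ℬ` and lift it to an object with property `P`. Maps out of
such objects are computed in `ℬ`, so the lift is a colimit in `𝒜` and agrees with the given one. -/
lemma property_of_isColimit (h : IsCoreflection G P) [P.IsClosedUnderIsomorphisms]
    {J : Type u₃} [Category.{v₃} J] [Limits.HasColimitsOfShape J ℬ] {D : J ⥤ 𝒜}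
    (hD : ∀ j, P (D.obj j)) {c : Limits.Cocone D} (hc : Limits.IsColimit c) : P c.pt := by
  obtain ⟨F, hF, ⟨e⟩⟩ := h.exists_iso (Limits.colimit (D ⋙ G))
  let c' : Limits.Cocone D :=
    { pt := F
      ι :=
        { app := fun j => (h.homEquiv (hD j) F).symm (Limits.colimit.ι (D ⋙ G) j ≫ e.inv)
          naturality := fun i j f => h.hom_ext (hD i) (by
            have := Limits.colimit.w (D ⋙ G) f
            dsimp at this
            simp [reassoc_of% this]) } }
  have hι (j : J) : G.map (c'.ι.app j) = Limits.colimit.ι (D ⋙ G) j ≫ e.inv :=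
    h.map_homEquiv_symm _ _
  let desc (s : Limits.Cocone D) : F ⟶ s.pt :=
    (h.homEquiv hF _).symm (e.hom ≫ Limits.colimit.desc (D ⋙ G) (G.mapCocone s))
  have hdesc (s : Limits.Cocone D) : G.map (desc s) =
      e.hom ≫ Limits.colimit.desc (D ⋙ G) (G.mapCocone s) := h.map_homEquiv_symm _ _
  have hc' : Limits.IsColimit c' :=
    { desc := desc
      fac := fun s j => h.hom_ext (hD j) (by
        rw [G.map_comp, hι, hdesc]
        simp)
      uniq := fun s m hm => h.hom_ext hF (by
        rw [hdesc, ← cancel_epi e.inv]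
        refine Limits.colimit.hom_ext fun j => ?_
        rw [← reassoc_of% (hι j), ← G.map_comp, hm]
        simp) }
  exact P.prop_of_iso (hc'.coconePointUniqueUpToIso hc) hF

end IsCoreflection

/-! ### Universal arrows under coreflections -/

section Fork

variable {D₁ : Type u₁} {D₂ : Type u₂} [Category.{v₁} D₁] [Category.{v₂} D₂]

/-- Yoneda: the transpose of `k` is invertible exactly when `k` is a universal arrow from `N` to
`L`. This form no longer mentions `E`. -/
lemma isIso_homEquiv_symm_iff {E : D₁ ⥤ D₂} {L : D₂ ⥤ D₁} (adj : E ⊣ L) {N : D₁} {P : D₂}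
    (k : N ⟶ L.obj P) : IsIso ((adj.homEquiv N P).symm k) ↔
      ∀ Z : D₂, Function.Bijective fun g : P ⟶ Z => k ≫ L.map g := by
  rw [isIso_iff_coyoneda_map_bijective]
  refine forall_congr' fun Z => ?_
  rw [← Function.Bijective.of_comp_iff' (adj.homEquiv N Z).bijective]
  refine iff_of_eq (congrArg _ (funext fun g => ?_))
  simp [Adjunction.homEquiv_unit, Adjunction.homEquiv_counit]

variable {B₁ : Type u₃} {B₂ : Type u₄} [Category.{v₃} B₁] [Category.{v₄} B₂]

/-- Universal arrows between objects in the coreflective subcategories can be tested on the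
coreflections. -/
lemma isIso_homEquiv_symm_iff_of_isCoreflection {E : D₁ ⥤ D₂} {L : D₂ ⥤ D₁} (adj : E ⊣ L)
    {E' : B₁ ⥤ B₂} {L' : B₂ ⥤ B₁} (adj' : E' ⊣ L') {G₁ : D₁ ⥤ B₁} {G₂ : D₂ ⥤ B₂}
    (e : L ⋙ G₁ ≅ G₂ ⋙ L') {P₁ : ObjectProperty D₁} {P₂ : ObjectProperty D₂}
    (h₁ : IsCoreflection G₁ P₁) (h₂ : IsCoreflection G₂ P₂) {N : D₁} {P : D₂} (hN : P₁ N)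
    (hP : P₂ P) (k : N ⟶ L.obj P) : IsIso ((adj.homEquiv N P).symm k) ↔
      IsIso ((adj'.homEquiv _ _).symm (G₁.map k ≫ e.hom.app P)) := by
  rw [isIso_homEquiv_symm_iff, isIso_homEquiv_symm_iff]
  -- `N` and `P` lie in the coreflective classes, so both sides of the universal property are Hom
  -- sets out of such objects and may be computed after applying `G₁` and `G₂`; `Z` is arbitrary.
  have key (Z : D₂) : Function.Bijective (fun g : P ⟶ Z => k ≫ L.map g) ↔
      Function.Bijective fun g : G₂.obj P ⟶ G₂.obj Z =>
        (G₁.map k ≫ e.hom.app P) ≫ L'.map g := by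
    rw [← Function.Bijective.of_comp_iff' (h₁.homEquiv hN (L.obj Z)).bijective,
      ← Function.Bijective.of_comp_iff' ((Iso.refl _).homCongr (e.app Z)).bijective,
      ← Function.Bijective.of_comp_iff _ (h₂.homEquiv hP Z).bijective]
    refine iff_of_eq (congrArg _ (funext fun g => ?_))
    have := e.hom.naturality g
    dsimp at this
    simp [IsCoreflection.homEquiv, this]
  refine ⟨fun h Z => ?_, fun h Z => (key Z).2 (h _)⟩
  -- Universality downstairs must be tested against every object of `B₂`, and each of these is
  -- isomorphic to some `G₂.obj F`.
  obtain ⟨F, -, ⟨i⟩⟩ := h₂.exists_iso Z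
  have := (key F).1 (h F)
  rw [← Function.Bijective.of_comp_iff' ((Iso.refl _).homCongr (L'.mapIso i)).bijective] at this
  rw [← Function.Bijective.of_comp_iff _ ((Iso.refl _).homCongr i).bijective]
  convert this using 1
  funext g
  simp

end Fork

end Coreflective

/-! ### Sheaves of modules associated to their global sections -/

namespace SheafOfModules

variable {C : Type u₁} [Category.{v₁} C] {J : GrothendieckTopology C} {R : Sheaf J RingCat.{u}}
  {t : C} (ht : Limits.IsTerminal t)

/-- The restriction maps of a sheaf of modules. -/
noncomputable def res (F : SheafOfModules.{u} R) {U V : C} (i : V ⟶ U) :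
    F.val.obj (op U) →ₛₗ[(R.obj.map i.op).hom] F.val.obj (op V) :=
  F.val.restrictₛₗ i.op

lemma res_id (F : SheafOfModules.{u} R) {U : C} (i : U ⟶ U) (hi : i = 𝟙 U)
    (s : F.val.obj (op U)) : F.res i s = s := by
  subst hi
  change F.val.map (𝟙 (op U)) s = s
  rw [PresheafOfModules.map_id]
  rfl

lemma res_res (F : SheafOfModules.{u} R) {U V W : C} (i : V ⟶ U) (j : W ⟶ V)
    (s : F.val.obj (op U)) : F.res j (F.res i s) = F.res (j ≫ i) s :=
  (F.val.map_comp_apply i.op j.op s).symm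

lemma app_res {F H : SheafOfModules.{u} R} (f : F ⟶ H) {U V : C} (i : V ⟶ U)
    (s : F.val.obj (op U)) : f.val.app (op V) (F.res i s) = H.res i (f.val.app (op U) s) :=
  PresheafOfModules.naturality_apply f.val i.op s

/-- The global functions that vanish on `U`. -/
def vanishing (R : Sheaf J RingCat.{u}) {U V : C} (i : V ⟶ U) : Ideal (R.obj.obj (op U)) :=
  RingHom.ker (R.obj.map i.op).hom

/-- The sections of `F` over `U` are the quotient of the global sections by the multiples of the
global functions that vanish on `U`. -/
def isAssociated (R : Sheaf J RingCat.{u}) : ObjectProperty (SheafOfModules.{u} R) := fun F =>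
  ∀ U : C, Function.Surjective (F.res (ht.from U)) ∧
    ∀ s : F.val.obj (op t), F.res (ht.from U) s = 0 →
      s ∈ vanishing R (ht.from U) • (⊤ : Submodule (R.obj.obj (op t)) (F.val.obj (op t)))

/-- A function that vanishes on `U` is itself times the global section `1`. -/
lemma isAssociated_unit (hR : ∀ U, Function.Surjective (R.obj.map (ht.from U).op)) :
    isAssociated ht R (unit R) := fun U =>
  ⟨hR U, fun (s : R.obj.obj (op t)) hs => by
    have := Submodule.smul_mem_smul (I := vanishing R (ht.from U)) (r := s)
      hs (Submodule.mem_top (x := (1 : R.obj.obj (op t))))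
    have h : s • (1 : R.obj.obj (op t)) = s := mul_one s
    rwa [h] at this⟩

lemma app_mem_smul {F H : SheafOfModules.{u} R} {U V : C} {i : V ⟶ U}
    (φ : F.val.obj (op U) ⟶ H.val.obj (op U)) {s : F.val.obj (op U)}
    (hs : s ∈ vanishing R i • (⊤ : Submodule (R.obj.obj (op U)) (F.val.obj (op U)))) :
    φ s ∈ vanishing R i • (⊤ : Submodule (R.obj.obj (op U)) (H.val.obj (op U))) := by
  have := Submodule.mem_map_of_mem (f := φ.hom) hs
  rw [Submodule.map_smul''] at this
  exact Submodule.smul_mono le_rfl le_top this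

lemma res_eq_zero_of_mem_smul {H : SheafOfModules.{u} R} {U V : C} {i : V ⟶ U}
    {s : H.val.obj (op U)}
    (hs : s ∈ vanishing R i • (⊤ : Submodule (R.obj.obj (op U)) (H.val.obj (op U)))) :
    H.res i s = 0 := by
  induction hs using Submodule.smul_induction_on' with
  | smul r hr x _ =>
    have : (R.obj.map i.op).hom r = 0 := hr
    rw [map_smulₛₗ, this, zero_smul]
  | add x _ y _ hx hy => rw [map_add, hx, hy, add_zero]

instance : (isAssociated ht R).IsClosedUnderIsomorphisms where
  of_iso {F H} e hF U := by
    have h (V) (x) : e.hom.val.app V (e.inv.val.app V x) = x :=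
      congr($(e.inv_hom_id).val.app V x)
    refine ⟨fun x => ?_, fun s hs => ?_⟩
    · obtain ⟨y, hy⟩ := (hF U).1 (e.inv.val.app (op U) x)
      exact ⟨e.hom.val.app _ y, by rw [← app_res, hy, h]⟩
    · have := app_mem_smul (e.hom.val.app (op t)) ((hF U).2 (e.inv.val.app _ s) (by
        rw [← app_res, hs, map_zero]))
      rwa [h] at this

/-- A map out of an associated sheaf is determined by its effect on global sections. -/
lemma isAssociated.evaluation_map_injective {F : SheafOfModules.{u} R} (hF : isAssociated ht R F)
    (H : SheafOfModules.{u} R) :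
    Function.Injective ((evaluation R (op t)).map : (F ⟶ H) → _) := fun f g hfg => by
  ext U x
  obtain ⟨y, rfl⟩ := (hF U.unop).1 x
  have h : f.val.app (op t) y = g.val.app (op t) y := congr($hfg y)
  exact (app_res f _ y).trans ((congrArg _ h).trans (app_res g _ y).symm)

/-- A linear map of global sections out of an associated sheaf extends to a map of sheaves. -/
lemma isAssociated.evaluation_map_surjective
    (hR : ∀ U, Function.Surjective (R.obj.map (ht.from U).op)) {F : SheafOfModules.{u} R}
    (hF : isAssociated ht R F) (H : SheafOfModules.{u} R) :
    Function.Surjective ((evaluation R (op t)).map : (F ⟶ H) → _) := fun φ => by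
  change F.val.obj (op t) ⟶ H.val.obj (op t) at φ
  -- Independence of the lift: the difference of two lifts is a combination of sections with
  -- coefficients vanishing on `U`. A linear map preserves this shape, and restriction to `U` kills
  -- it.
  have hφ (U : C) (s s' : F.val.obj (op t)) (hs : F.res (ht.from U) s = F.res (ht.from U) s') :
      H.res (ht.from U) (φ s) = H.res (ht.from U) (φ s') := by
    rw [← sub_eq_zero, ← map_sub, ← map_sub]
    exact res_eq_zero_of_mem_smul (app_mem_smul φ ((hF U).2 _ (by rw [map_sub, hs, sub_self])))
  let l (U : C) (x : F.val.obj (op U)) : F.val.obj (op t) := Function.surjInv (hF U).1 x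
  have hl (U : C) (x : F.val.obj (op U)) : F.res (ht.from U) (l U x) = x :=
    Function.surjInv_eq (hF U).1 x
  let ψ (U : Cᵒᵖ) : F.val.obj U ⟶ H.val.obj U := ModuleCat.ofHom
    { toFun := fun x => H.res (ht.from U.unop) (φ (l U.unop x))
      map_add' := fun x y => by
        refine (hφ U.unop _ (l U.unop x + l U.unop y) ?_).trans (by rw [map_add, map_add])
        exact (hl _ _).trans ((congrArg₂ (· + ·) (hl _ x) (hl _ y)).symm.trans (map_add _ _ _).symm)
      map_smul' := fun r x => by
        obtain ⟨r, rfl⟩ := hR U.unop r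
        refine (hφ U.unop _ (r • l U.unop x) ?_).trans (by rw [map_smul, map_smulₛₗ]; rfl)
        rw [map_smulₛₗ]
        exact (hl _ _).trans (congrArg _ (hl _ x)).symm }
  have hψ (U : C) (s : F.val.obj (op t)) : ψ (op U) (F.res (ht.from U) s) =
      H.res (ht.from U) (φ s) := hφ U _ _ (hl U _)
  refine ⟨⟨⟨ψ, fun {U V} f => ?_⟩⟩, ?_⟩
  · ext x
    obtain ⟨y, rfl⟩ := (hF U.unop).1 x
    change ψ (op V.unop) (F.res f.unop (F.res (ht.from U.unop) y)) =
      H.res f.unop (ψ (op U.unop) (F.res (ht.from U.unop) y))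
    rw [hψ, res_res, res_res, ht.hom_ext (f.unop ≫ ht.from U.unop) (ht.from V.unop), hψ]
  · ext x
    change F.val.obj (op t) at x
    have h := hψ t x
    rwa [res_id _ _ (ht.hom_ext _ _), res_id _ _ (ht.hom_ext _ _)] at h

/-- Full faithfulness on associated sheaves is formal; only the existence of a sheaf with given
global sections has to be supplied. -/
lemma isCoreflection_isAssociated
    (hR : ∀ U, Function.Surjective (R.obj.map (ht.from U).op))
    (hM : ∀ M : ModuleCat.{u} (R.obj.obj (op t)), ∃ F : SheafOfModules.{u} R,
      isAssociated ht R F ∧ Nonempty ((evaluation R (op t)).obj F ≅ M)) :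
    IsCoreflection (evaluation R (op t)) (isAssociated ht R) where
  bijective hF H := ⟨hF.evaluation_map_injective ht H, hF.evaluation_map_surjective ht hR H⟩
  exists_iso := hM

/-- The global section of a sheaf of modules with a given value on the terminal object. -/
noncomputable def sectionOfTerminal (F : SheafOfModules.{u} R) (s : F.val.obj (op t)) :
    F.sections :=
  PresheafOfModules.sectionsMk (fun U => F.res (ht.from U.unop) s) (fun U V f => by
    refine (F.res_res (ht.from U.unop) f.unop s).trans ?_
    rw [ht.hom_ext (f.unop ≫ ht.from U.unop) (ht.from V.unop)])

lemma sectionOfTerminal_eval (F : SheafOfModules.{u} R) (s : F.val.obj (op t)) :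
    (F.sectionOfTerminal ht s).eval (op t) = s :=
  F.res_id _ (ht.hom_ext _ _) s

lemma sections_ext_of_isTerminal (ht : Limits.IsTerminal t) {F : SheafOfModules.{u} R}
    {s s' : F.sections} (h : s.eval (op t) = s'.eval (op t)) : s = s' :=
  PresheafOfModules.sections_ext _ _ fun U =>
    (PresheafOfModules.sections_property s (ht.from U.unop).op).symm.trans
      ((congrArg (F.val.map (ht.from U.unop).op) h).trans
        (PresheafOfModules.sections_property s' (ht.from U.unop).op))

/-! ### Presentations of associated sheaves -/

section Presentation

variable [HasSheafify J AddCommGrpCat.{u}] [J.WEqualsLocallyBijective AddCommGrpCat.{u}]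

/-- The structure sheaf is associated, and the coreflective class is closed under colimits, hence
contains free sheaves and their cokernels. -/
lemma isAssociated_of_presentation (hR : ∀ U, Function.Surjective (R.obj.map (ht.from U).op))
    (h : IsCoreflection (evaluation R (op t)) (isAssociated ht R)) {F : SheafOfModules.{u} R}
    (p : F.Presentation) : isAssociated ht R F := by
  have hfree (I : Type u) : isAssociated ht R (free I) :=
    h.property_of_isColimit (fun _ => isAssociated_unit ht hR) (isColimitFreeCofan I)
  refine h.property_of_isColimit ?_ p.isColimit
  rintro (_ | _)
  · exact hfree _
  · exact hfree _

/-- A map out of a free sheaf is given by the images of the basis sections, each determined by its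
value on the terminal object. -/
lemma free_hom_ext_of_isTerminal (ht : Limits.IsTerminal t) {F : SheafOfModules.{u} R} {I : Type u} {f g : free I ⟶ F}
    (h : (evaluation R (op t)).map f = (evaluation R (op t)).map g) : f = g := by
  refine F.freeHomEquiv.injective (funext fun i => sections_ext_of_isTerminal ht ?_)
  exact congr($h ((freeSection i).eval (op t)))

/-- An associated sheaf has a global presentation. -/
lemma isAssociated.nonempty_presentation
    (h : IsCoreflection (evaluation R (op t)) (isAssociated ht R)) {F : SheafOfModules.{u} R}
    (hF : isAssociated ht R F) : Nonempty F.Presentation := by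
  let G := evaluation.{u} R (op t)
  let g : free (R := R) (F.val.obj (op t)) ⟶ F :=
    F.freeHomEquiv.symm fun s => F.sectionOfTerminal ht s
  have hg (s : F.val.obj (op t)) : G.map g ((freeSection s).eval (op t)) = s := by
    have := sectionsMap_freeHomEquiv_symm_freeSection (fun s => F.sectionOfTerminal ht s) s
    exact (congrArg (fun x : F.sections => x.eval (op t)) this).trans
      (F.sectionOfTerminal_eval ht s)
  -- Generators are all global sections of `F`; relations are all elements of the kernel on global
  -- sections.
  let K := LinearMap.ker (G.map g).hom
  let f : free (R := R) K ⟶ free (F.val.obj (op t)) :=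
    (freeHomEquiv _).symm fun s => sectionOfTerminal ht _ s.1
  have hf (s : K) : G.map f ((freeSection s).eval (op t)) = s.1 := by
    have := sectionsMap_freeHomEquiv_symm_freeSection
      (fun s : K => sectionOfTerminal ht (free (R := R) (F.val.obj (op t))) s.1) s
    exact (congrArg (fun x : sections _ => x.eval (op t)) this).trans
      (sectionOfTerminal_eval ht _ s.1)
  have hfg : f ≫ g = 0 := by
    refine F.freeHomEquiv.injective (funext fun s => sections_ext_of_isTerminal ht ?_)
    change G.map g (G.map f ((freeSection s).eval (op t))) = 0
    rw [hf]
    exact s.2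
  have hsurj : Function.Surjective (G.map g).hom := fun s => ⟨_, hg s⟩
  have hdesc (Z : SheafOfModules.{u} R) (k : free (F.val.obj (op t)) ⟶ Z) (hk : f ≫ k = 0) :
      ∃ d : F ⟶ Z, g ≫ d = k := by
    -- A map that kills the relations descends on global sections; since `F` is associated, the
    -- descended linear map then extends to sheaves.
    have hker : LinearMap.ker (G.map g).hom ≤ LinearMap.ker (G.map k).hom := fun s hs => by
      have : G.map k (G.map f ((freeSection (⟨s, hs⟩ : K)).eval (op t))) = 0 :=
        congr(G.map $hk ((freeSection (⟨s, hs⟩ : K)).eval (op t)))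
      rwa [hf] at this
    let d := ((LinearMap.ker (G.map g).hom).liftQ (G.map k).hom hker).comp
      ((G.map g).hom.quotKerEquivOfSurjective hsurj).symm.toLinearMap
    have hd (s) : d ((G.map g).hom s) = (G.map k).hom s := by
      change (LinearMap.ker (G.map g).hom).liftQ (G.map k).hom hker
        (((G.map g).hom.quotKerEquivOfSurjective hsurj).symm ((G.map g).hom s)) = _
      have : ((G.map g).hom.quotKerEquivOfSurjective hsurj).symm ((G.map g).hom s) =
          (LinearMap.ker (G.map g).hom).mkQ s := by
        rw [LinearEquiv.symm_apply_eq]; rfl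
      rw [this]; rfl
    have hd' : G.map g ≫ ModuleCat.ofHom d = G.map k := by
      ext s
      exact hd s
    obtain ⟨d', h'⟩ := (h.bijective hF Z).2 (ModuleCat.ofHom d)
    exact ⟨d', free_hom_ext_of_isTerminal ht
      ((G.map_comp g d').trans ((congrArg (G.map g ≫ ·) h').trans hd'))⟩
  refine ⟨presentationOfIsCokernelFree f g hfg (Limits.CokernelCofork.IsColimit.ofπ _ _
    (fun k hk => (hdesc _ k hk).choose) (fun k hk => (hdesc _ k hk).choose_spec)
    (fun k hk m hm => h.hom_ext hF ?_))⟩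
  have := hm.trans (hdesc _ k hk).choose_spec.symm
  ext s
  obtain ⟨s, rfl⟩ := hsurj s
  exact congr(G.map $this s)

end Presentation

end SheafOfModules

/-! ### Split families of ideals -/

section SplitFamily

variable {X : Type u₁} [TopologicalSpace X] {R : Type u₂} [CommRing R]

/-- A family of ideals generated by idempotents, indexed by the open sets of a space, that behaves
like the family of ideals of global functions that vanish on a given open set. -/
structure IsSplitFamily (I : Opens X → Ideal R) : Prop where
  idem (U : Opens X) : ∃ e, IsIdempotentElem e ∧ I U = Ideal.span {e}
  anti : Antitone I
  mem_sSup (S : Set (Opens X)) (r : R) (hr : ∀ U ∈ S, r ∈ I U) : r ∈ I (sSup S)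
  inf_le (U V : Opens X) : I (U ⊓ V) ≤ I U ⊔ I V

lemma mem_span_singleton_smul_iff {M : Type u₃} [AddCommGroup M] [Module R M] {e : R}
    (he : IsIdempotentElem e) {m : M} :
    m ∈ Ideal.span {e} • (⊤ : Submodule R M) ↔ (1 - e) • m = 0 := by
  rw [Submodule.ideal_span_singleton_smul, Submodule.mem_smul_pointwise_iff_exists, sub_smul,
    one_smul, sub_eq_zero]
  constructor
  · rintro ⟨n, -, rfl⟩
    rw [smul_smul, he.eq]
  · intro h
    exact ⟨m, trivial, h.symm⟩

namespace IsSplitFamily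

variable {I : Opens X → Ideal R} (hI : IsSplitFamily I)

/-- The idempotent that generates a member of a split family. -/
noncomputable def gen (U : Opens X) : R := (hI.idem U).choose

lemma isIdempotentElem_gen (U : Opens X) : IsIdempotentElem (hI.gen U) :=
  (hI.idem U).choose_spec.1

lemma eq_span_gen (U : Opens X) : I U = Ideal.span {hI.gen U} :=
  (hI.idem U).choose_spec.2

lemma gen_mem (U : Opens X) : hI.gen U ∈ I U := by
  rw [hI.eq_span_gen U]
  exact Ideal.mem_span_singleton_self _

variable {M : Type u₃} [AddCommGroup M] [Module R M]

lemma mem_smul_top_iff {U : Opens X} {m : M} :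
    m ∈ I U • (⊤ : Submodule R M) ↔ (1 - hI.gen U) • m = 0 := by
  rw [hI.eq_span_gen U, mem_span_singleton_smul_iff (hI.isIdempotentElem_gen U)]

/-- By `inf_le`, `m` is a sum of a part killed by `1 - gen U` and a part killed by `1 - gen V`. -/
lemma smul_eq_zero_of_mem_inf {U V : Opens X} {m : M}
    (hm : m ∈ I (U ⊓ V) • (⊤ : Submodule R M)) :
    (1 - hI.gen U) • (1 - hI.gen V) • m = 0 := by
  have hm' := Submodule.smul_mono (hI.inf_le U V) le_rfl hm
  rw [Submodule.sup_smul, Submodule.mem_sup] at hm'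
  obtain ⟨a, ha, b, hb, rfl⟩ := hm'
  rw [hI.mem_smul_top_iff] at ha hb
  rw [smul_add, smul_add, hb, smul_comm, ha, smul_zero, smul_zero, add_zero]

variable [NoetherianSpace X]

lemma exists_finset_iSup_eq {ι : Type v₁} (U : ι → Opens X) :
    ∃ s : Finset ι, ⨆ i, U i = ⨆ i ∈ s, U i := by
  have h := (CompleteLattice.isSupFiniteCompact_iff_all_elements_compact (Opens X)).1
    (CompleteLattice.WellFoundedGT.isSupFiniteCompact (Opens X)) (⨆ i, U i)
  obtain ⟨s, hs⟩ := CompleteLattice.IsCompactElement.exists_finset_of_le_iSup _ h U le_rfl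
  exact ⟨s, le_antisymm hs (iSup₂_le fun i _ => le_iSup U i)⟩

lemma mem_iSup_smul_top (hI : IsSplitFamily I) {ι : Type v₁} (U : ι → Opens X) {m : M}
    (hm : ∀ i, m ∈ I (U i) • (⊤ : Submodule R M)) :
    m ∈ I (⨆ i, U i) • (⊤ : Submodule R M) := by
  obtain ⟨s, hs⟩ := exists_finset_iSup_eq U
  -- Each generator fixes `m`, hence so does their product, which lies in every `I (U i)` and
  -- therefore in the ideal of the union. Noetherianity makes the product finite.
  have hprod (s : Finset ι) : (∏ i ∈ s, hI.gen (U i)) • m = m := by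
    classical
    induction s using Finset.induction_on with
    | empty => simp
    | insert i s hi ih =>
      have := hI.mem_smul_top_iff.1 (hm i)
      rw [sub_smul, one_smul, sub_eq_zero] at this
      rw [Finset.prod_insert hi, mul_smul, ih, ← this]
  rw [← hprod s, hs]
  refine Submodule.smul_mem_smul ?_ trivial
  have := hI.mem_sSup (U '' s) (∏ i ∈ s, hI.gen (U i)) (by
    rintro _ ⟨i, hi, rfl⟩
    exact Ideal.mem_of_dvd _ (Finset.dvd_prod_of_mem _ hi) (hI.gen_mem _))
  simpa [sSup_image] using this

/-- Compatible families of elements modulo the members of a split family can be glued. -/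
lemma exists_gluing (hI : IsSplitFamily I) {ι : Type v₁} (U : ι → Opens X) (m : ι → M)
    (hm : ∀ i j, m i - m j ∈ I (U i ⊓ U j) • (⊤ : Submodule R M)) :
    ∃ n : M, ∀ i, n - m i ∈ I (U i) • (⊤ : Submodule R M) := by
  classical
  have hfin (s : Finset ι) : ∃ n : M, ∀ i ∈ s, n - m i ∈ I (U i) • (⊤ : Submodule R M) := by
    induction s using Finset.induction_on with
    | empty => exact ⟨0, by simp⟩
    | insert i s hi ih =>
      obtain ⟨n, hn⟩ := ih
      simp only [hI.mem_smul_top_iff] at hn ⊢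
      -- The correction changes `n` to `m i` on `U i`. On an earlier `U j` it is invisible, because
      -- `m i` and `n` already agree on `U i ⊓ U j`.
      refine ⟨n + (1 - hI.gen (U i)) • (m i - n), fun j hj => ?_⟩
      have hidem := (hI.isIdempotentElem_gen (U i)).one_sub.eq
      obtain rfl | hj := Finset.mem_insert.1 hj
      · rw [add_sub_right_comm, smul_add, smul_smul, hidem, ← smul_add, sub_add_sub_cancel,
          sub_self, smul_zero]
      · have h₁ := hI.smul_eq_zero_of_mem_inf (hm i j)
        have h₂ : m i - n = (m i - m j) - (n - m j) := by abel
        rw [add_sub_right_comm, smul_add, hn j hj, zero_add, smul_comm, h₂, smul_sub, hn j hj,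
          sub_zero, h₁]
  obtain ⟨s, hs⟩ := exists_finset_iSup_eq U
  obtain ⟨n, hn⟩ := hfin s
  refine ⟨n, fun i => ?_⟩
  -- An index outside the finite subcover is handled by comparing `n` with `m i` on each `U i ⊓ U
  -- j`, where both agree with `m j`.
  have hi : U i = ⨆ j : s, U i ⊓ U j := by
    rw [← inf_iSup_eq, iSup_subtype, ← hs, inf_eq_left.2 (le_iSup U i)]
  rw [hi]
  refine hI.mem_iSup_smul_top _ fun j => ?_
  have h₁ := Submodule.smul_mono (hI.anti (inf_le_right (a := U i) (b := U j))) le_rfl (hn j j.2)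
  have h₂ := hm i j
  have h₃ : n - m i = (n - m j) - (m i - m j) := by abel
  rw [h₃]
  exact sub_mem h₁ h₂

end IsSplitFamily

end SplitFamily

/-! ### Split sheaves of rings -/

namespace TorsionCurve

section SplitSheaf

variable {X : TopCat.{u}} (A : Sheaf (Opens.grothendieckTopology X) CommRingCat.{u})

/-- Restriction of global functions to an open set. -/
def resTop (U : Opens X) : Γ A →+* A.obj.obj (op U) :=
  (A.obj.map (homOfLE (le_top : U ≤ ⊤)).op).hom

lemma map_resTop {U V : Opens X} (i : V ⟶ U) (r : Γ A) :
    (A.obj.map i.op).hom (resTop A U r) = resTop A V r :=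
  congr($((A.obj.map_comp (homOfLE (le_top : U ≤ ⊤)).op i.op).symm).hom r)

lemma app_resTop {A B : Sheaf (Opens.grothendieckTopology X) CommRingCat.{u}} (f : A ⟶ B)
    (U : Opens X) (r : Γ A) :
    (f.hom.app (op U)).hom (resTop A U r) = resTop B U (Γmap f r) :=
  congr($(f.hom.naturality (homOfLE (le_top : U ≤ ⊤)).op).hom r)

lemma resTop_top (r : Γ A) : resTop A ⊤ r = r :=
  congr($(A.obj.map_id (op ⊤)).hom r)

/-- The ideal of global functions that vanish on an open set. -/
def vanishingIdeal (U : Opens X) : Ideal (Γ A) := RingHom.ker (resTop A U)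

/-- A sheaf of rings is split if restricting global functions to an open set always amounts to
projecting to a direct factor of the ring of global functions. -/
structure IsSplit : Prop where
  surjective (U : Opens X) : Function.Surjective (resTop A U)
  idem (U : Opens X) : ∃ e, IsIdempotentElem e ∧ vanishingIdeal A U = Ideal.span {e}

variable {A}

lemma eq_of_resTop_eq {ι : Type u} (U : ι → Opens X) (hU : ⨆ i, U i = ⊤) {r s : Γ A}
    (h : ∀ i, resTop A (U i) r = resTop A (U i) s) : r = s :=
  TopCat.Sheaf.eq_of_locally_eq' (F := A) U ⊤ (fun _ => homOfLE le_top) hU.ge r s h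

/-- Separatedness of the sheaf gives `mem_sSup`, and gluing followed by lifting to a global function
gives `inf_le`. -/
lemma IsSplit.isSplitFamily (hA : IsSplit A) : IsSplitFamily (vanishingIdeal A) where
  idem := hA.idem
  anti U V h r hr := by
    change resTop A V r = 0 at hr
    change resTop A U r = 0
    rw [← map_resTop A (homOfLE h), hr, map_zero]
  mem_sSup S r hr := by
    refine TopCat.Sheaf.eq_of_locally_eq' (F := A) (fun U : S => U.1) (sSup S)
      (fun U => homOfLE (le_sSup U.2)) (by rw [sSup_eq_iSup']) _ _ fun U => ?_
    refine (map_resTop A _ r).trans ?_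
    exact (hr U U.2).trans (map_zero (A.obj.map (homOfLE (le_sSup U.2)).op).hom).symm
  inf_le U V a ha := by
    let W : Bool → Opens X := fun b => bif b then U else V
    -- A function vanishing on `U ⊓ V` glues with `0`: the result `b` equals `a` on `U` and `0` on
    -- `V`, so `a = (a - b) + b` is the desired splitting.
    let sf : ∀ b, A.obj.obj (op (W b)) := fun b => match b with
      | true => resTop A U a
      | false => 0
    obtain ⟨b, hb, -⟩ := TopCat.Sheaf.existsUnique_gluing (F := A) W sf (by
      have h0 : resTop A (U ⊓ V) a = 0 := ha
      have h0' : resTop A (V ⊓ U) a = 0 := by rw [inf_comm]; exact ha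
      rintro (_ | _) (_ | _)
      · rfl
      · exact (map_zero (A.obj.map _).hom).trans ((map_resTop A _ a).trans h0').symm
      · exact ((map_resTop A _ a).trans h0).trans (map_zero (A.obj.map _).hom).symm
      · rfl)
    obtain ⟨b, rfl⟩ := hA.surjective _ b
    have hU : resTop A U b = resTop A U a := (map_resTop A _ b).symm.trans (hb true)
    have hV : resTop A V b = 0 := (map_resTop A _ b).symm.trans (hb false)
    refine Submodule.mem_sup.2 ⟨a - b, ?_, b, hV, sub_add_cancel a b⟩
    change resTop A U (a - b) = 0
    rw [map_sub, hU, sub_self]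

lemma IsSplit.of_iso {B : Sheaf (Opens.grothendieckTopology X) CommRingCat.{u}} (e : A ≅ B)
    (hA : IsSplit A) : IsSplit B := by
  have h (U : Opens X) (x) : (e.hom.hom.app (op U)).hom ((e.inv.hom.app (op U)).hom x) = x :=
    congr(($(e.inv_hom_id).hom.app (op U)).hom x)
  have h' (U : Opens X) (x) : (e.inv.hom.app (op U)).hom ((e.hom.hom.app (op U)).hom x) = x :=
    congr(($(e.hom_inv_id).hom.app (op U)).hom x)
  refine ⟨fun U x => ?_, fun U => ?_⟩
  · obtain ⟨y, hy⟩ := hA.surjective U ((e.inv.hom.app (op U)).hom x)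
    exact ⟨Γmap e.hom y, by rw [← app_resTop, hy, h]⟩
  · obtain ⟨f, hf, hf'⟩ := hA.idem U
    refine ⟨Γmap e.hom f, hf.map _, Ideal.ext fun x => ?_⟩
    have hx : x ∈ vanishingIdeal B U ↔ Γmap e.inv x ∈ vanishingIdeal A U := by
      constructor
      · intro (hx : resTop B U x = 0)
        change resTop A U _ = 0
        rw [← app_resTop, hx, map_zero]
      · intro (hx : resTop A U _ = 0)
        change resTop B U _ = 0
        rw [← h ⊤ x, ← app_resTop, hx, map_zero]
    rw [hx, hf', Ideal.mem_span_singleton', Ideal.mem_span_singleton']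
    constructor
    · rintro ⟨a, ha⟩
      exact ⟨Γmap e.hom a, by rw [← map_mul, ha]; exact h ⊤ x⟩
    · rintro ⟨a, ha⟩
      refine ⟨Γmap e.inv a, ?_⟩
      rw [← ha, map_mul]
      exact congrArg _ (h' ⊤ f).symm

end SplitSheaf

end TorsionCurve

/-! ### Restricting associated sheaves to an object of the site -/

namespace SheafOfModules

variable {C : Type u₁} [Category.{v₁} C] {J : GrothendieckTopology C} {R : Sheaf J RingCat.{u}}
  {t : C} (ht : Limits.IsTerminal t)

lemma surjective_map_of_isTerminal (hR : ∀ U, Function.Surjective (R.obj.map (ht.from U).op))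
    {U V : C} (i : V ⟶ U) : Function.Surjective (R.obj.map i.op) := fun r => by
  obtain ⟨r, rfl⟩ := hR V r
  refine ⟨R.obj.map (ht.from U).op r, ?_⟩
  rw [← ConcreteCategory.comp_apply, ← Functor.map_comp, ← op_comp, ht.hom_ext (i ≫ ht.from U)]

/-- The sections over `U` and over a smaller object are both quotients of the global sections, so
the second is a quotient of the first, by the images of the same vanishing functions. -/
lemma isAssociated.over {F : SheafOfModules.{u} R} (hF : isAssociated ht R F) (U : C) :
    isAssociated Over.mkIdTerminal (R.over U) (F.over U) := fun Z => by
  set i : Z.left ⟶ U := (Over.mkIdTerminal.from Z).left with hi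
  have hres (s : F.val.obj (op t)) : F.res i (F.res (ht.from U) s) = F.res (ht.from Z.left) s := by
    rw [res_res, ht.hom_ext (i ≫ ht.from U)]
  refine ⟨fun (x : F.val.obj (op Z.left)) => ?_, fun (s : F.val.obj (op U)) hs => ?_⟩
  · obtain ⟨y, rfl⟩ := (hF Z.left).1 x
    exact ⟨F.res (ht.from U) y, hres y⟩
  · obtain ⟨s, rfl⟩ := (hF U).1 s
    have hs' := (hF Z.left).2 s ((hres s).symm.trans hs)
    change F.res (ht.from U) s ∈
      vanishing R i • (⊤ : Submodule (R.obj.obj (op U)) (F.val.obj (op U)))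
    clear hs
    induction hs' using Submodule.smul_induction_on' with
    | smul r hr x _ =>
      rw [map_smulₛₗ]
      refine Submodule.smul_mem_smul ?_ trivial
      change R.obj.map i.op (R.obj.map (ht.from U).op r) = 0
      rw [← ConcreteCategory.comp_apply, ← Functor.map_comp, ← op_comp, ht.hom_ext (i ≫ ht.from U)]
      exact hr
    | add x _ y _ hx hy => rw [map_add]; exact add_mem hx hy

/-- A module over the functions on `U` is a module over the global functions on which those
vanishing on `U` act as zero. Its associated sheaf therefore has the same sections over `U` as
globally, and restricts to the sheaf wanted. -/
lemma isCoreflection_isAssociated_over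
    (hR : ∀ U, Function.Surjective (R.obj.map (ht.from U).op))
    (h : IsCoreflection (evaluation R (op t)) (isAssociated ht R)) (U : C) :
    IsCoreflection (evaluation (R.over U) (op (Over.mk (𝟙 U))))
      (isAssociated Over.mkIdTerminal (R.over U)) := by
  refine isCoreflection_isAssociated _
    (fun Z => surjective_map_of_isTerminal ht hR (Over.mkIdTerminal.from Z).left) fun M => ?_
  change ModuleCat.{u} (R.obj.obj (op U)) at M
  let ρ := (R.obj.map (ht.from U).op).hom
  obtain ⟨F, hF, ⟨e⟩⟩ := h.exists_iso ((ModuleCat.restrictScalars ρ).obj M)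
  refine ⟨F.over U, hF.over ht U, ⟨?_⟩⟩
  have he (x : F.val.obj (op t)) (hx : F.res (ht.from U) x = 0) : x = 0 := by
    have hx' := (hF U).2 x hx
    let e' : F.val.obj (op t) →ₗ[R.obj.obj (op t)] (ModuleCat.restrictScalars ρ).obj M := e.hom.hom
    have h2 : e' x = 0 := by
      clear hx
      induction hx' using Submodule.smul_induction_on' with
      | smul r hr x _ =>
        have hr' : ρ r = 0 := hr
        rw [map_smul]
        change ρ r • (show M from e' x) = 0
        rw [hr', zero_smul]
      | add x _ y _ hx hy => rw [map_add, hx, hy, add_zero]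
    replace h2 : e.hom.hom x = 0 := h2
    have h3 := congr($(e.hom_inv_id) x)
    change e.inv.hom (e.hom.hom x) = x at h3
    rw [← h3, h2, map_zero]
    rfl
  let g : F.val.obj (op t) →+ F.val.obj (op U) := (F.res (ht.from U)).toAddMonoidHom
  have hg : Function.Bijective g := ⟨(injective_iff_map_eq_zero g).2 he, (hF U).1⟩
  let ε : F.val.obj (op t) ≃+ M := e.toLinearEquiv.toAddEquiv
  have hε (r) (x : F.val.obj (op t)) : ε (r • x) = ρ r • ε x := map_smul e.toLinearEquiv r x
  let E : F.val.obj (op U) ≃+ M := (AddEquiv.ofBijective g hg).symm.trans ε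
  have hE (x : F.val.obj (op t)) : E (F.res (ht.from U) x) = ε x :=
    congrArg ε ((AddEquiv.ofBijective g hg).symm_apply_apply x)
  let L : F.val.obj (op U) ≃ₗ[R.obj.obj (op U)] M :=
    { E with
      map_smul' := fun r x => by
        obtain ⟨r, rfl⟩ := hR U r
        obtain ⟨x, rfl⟩ := (hF U).1 x
        change E (ρ r • F.res (ht.from U) x) = ρ r • E (F.res (ht.from U) x)
        rw [hE, ← hε, ← hE, (F.res (ht.from U)).map_smulₛₗ] }
  exact L.toModuleIso

end SheafOfModules

namespace TorsionCurve

open SheafOfModules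

section SplitSheaf

variable {X : TopCat.{u}} {A : Sheaf (Opens.grothendieckTopology X) CommRingCat.{u}}

/-- The action of the global functions on the sections over an open set. -/
noncomputable def act (F : ShMod A) (U : Opens X) : Γ A →+* AddMonoid.End (F.val.obj (op U)) :=
  (Module.toAddMonoidEnd ((ringSheaf A).obj.obj (op U)) (F.val.obj (op U))).comp (resTop A U)

lemma act_mul (F : ShMod A) (U : Opens X) (r r' : Γ A) (s : F.val.obj (op U)) :
    act F U (r * r') s = act F U r (act F U r' s) := by
  rw [map_mul]; rfl

lemma act_of_resTop_eq (F : ShMod A) {U : Opens X} {r r' : Γ A} (h : resTop A U r = resTop A U r')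
    (s : F.val.obj (op U)) : act F U r s = act F U r' s := by
  have : act F U r = act F U r' := congrArg
    (Module.toAddMonoidEnd ((ringSheaf A).obj.obj (op U)) (F.val.obj (op U))) h
  rw [this]

lemma res_act (F : ShMod A) {U V : Opens X} (i : V ⟶ U) (r : Γ A) (s : F.val.obj (op U)) :
    F.res i (act F U r s) = act F V r (F.res i s) :=
  ((F.res i).map_smulₛₗ _ s).trans
    (congrArg (fun x : (ringSheaf A).obj.obj (op V) => x • F.res i s) (map_resTop A i r))

lemma act_top (F : ShMod A) (r : (ringSheaf A).obj.obj (op ⊤)) (s : F.val.obj (op ⊤)) :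
    act F ⊤ r s = r • s :=
  congrArg (fun x : (ringSheaf A).obj.obj (op ⊤) => x • s) (resTop_top A r)

section Gluing

variable (F : ShMod A) {ι : Type u} (U : ι → Opens X) (V : Opens X) (hV : ∀ i, U i ≤ V)

lemma sections_ext_of_cover (hU : V ≤ ⨆ i, U i) {s s' : F.val.obj (op V)}
    (h : ∀ i, F.res (homOfLE (hV i)) s = F.res (homOfLE (hV i)) s') : s = s' :=
  TopCat.Sheaf.eq_of_locally_eq' (F := ⟨F.val.presheaf, F.isSheaf⟩) U V
    (fun i => homOfLE (hV i)) hU s s' h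

lemma exists_section_of_cover (hU : V ≤ ⨆ i, U i) (s : ∀ i, F.val.obj (op (U i)))
    (h : ∀ i j, F.res (homOfLE (inf_le_left : U i ⊓ U j ≤ U i)) (s i) =
      F.res (homOfLE (inf_le_right : U i ⊓ U j ≤ U j)) (s j)) :
    ∃ s' : F.val.obj (op V), ∀ i, F.res (homOfLE (hV i)) s' = s i := by
  let G : TopCat.Sheaf AddCommGrpCat.{u} X := ⟨F.val.presheaf, F.isSheaf⟩
  have hs : TopCat.Presheaf.IsCompatible G.obj U s := h
  obtain ⟨s', hs', -⟩ := TopCat.Sheaf.existsUnique_gluing' G U V (fun i => homOfLE (hV i)) hU s hs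
  exact ⟨s', hs'⟩

end Gluing

/-- For a module over a split sheaf of rings, being associated to the global sections is a local
property. -/
lemma isAssociated_of_cover (hA : IsSplit A) (F : ShMod A) {ι : Type u} (U : ι → Opens X)
    (hU : ⨆ i, U i = ⊤)
    (hF : ∀ i, isAssociated Over.mkIdTerminal ((ringSheaf A).over (U i)) (F.over (U i))) :
    isAssociated Limits.isTerminalTop (ringSheaf A) F := by
  have hI := hA.isSplitFamily
  have surj (i) {V : Opens X} (h : V ≤ U i) : Function.Surjective (F.res (homOfLE h)) :=
    (hF i (Over.mk (homOfLE h))).1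
  -- Inside a member of the cover, a section vanishing on `V` has coefficients in the ideal of `V`,
  -- which `1 - gen V` kills.
  have ker₁ (i) {V : Opens X} (h : V ≤ U i) (s : F.val.obj (op (U i)))
      (hs : F.res (homOfLE h) s = 0) : act F (U i) (1 - hI.gen V) s = 0 := by
    have hs' : s ∈ vanishing (ringSheaf A) (homOfLE h) •
      (⊤ : Submodule ((ringSheaf A).obj.obj (op (U i))) (F.val.obj (op (U i)))) :=
      (hF i (Over.mk (homOfLE h))).2 s hs
    clear hs
    induction hs' using Submodule.smul_induction_on' with
    | smul r hr x _ =>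
      obtain ⟨r, rfl⟩ := hA.surjective (U i) r
      have hr' : r ∈ vanishingIdeal A V := (map_resTop A (homOfLE h) r).symm.trans hr
      have h0 : (1 - hI.gen V) * r = 0 := by
        rw [hI.eq_span_gen V, Ideal.mem_span_singleton'] at hr'
        obtain ⟨a, rfl⟩ := hr'
        have := (hI.isIdempotentElem_gen V).eq
        linear_combination -a * this
      refine (act_mul F (U i) _ r x).symm.trans ?_
      rw [h0, map_zero]
      rfl
    | add x _ y _ hx hy => rw [map_add, hx, hy, add_zero]
  -- The same for a `V` not contained in the cover member: apply `ker₁` to `V ⊓ W`, after noting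
  -- that on `W`, where `gen W` is zero, `1 - gen V` is a multiple of `1 - gen (V ⊓ W)`.
  have ker (i) {W : Opens X} (hW : W ≤ U i) (V : Opens X) (s : F.val.obj (op W))
      (hs : F.res (homOfLE (inf_le_right : V ⊓ W ≤ W)) s = 0) :
      act F W (1 - hI.gen V) s = 0 := by
    obtain ⟨s, rfl⟩ := surj i hW s
    rw [res_res] at hs
    have h₁ := congrArg (F.res (homOfLE hW)) (ker₁ i (inf_le_right.trans hW) s hs)
    rw [res_act, map_zero] at h₁
    have h₂ : (1 - hI.gen V) * (1 - hI.gen W) * hI.gen (V ⊓ W) = 0 := by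
      have := hI.smul_eq_zero_of_mem_inf (M := Γ A) (U := V) (V := W) (m := hI.gen (V ⊓ W)) (by
        simpa using hI.gen_mem (V ⊓ W))
      simpa [mul_assoc] using this
    have h₃ : resTop A W (1 - hI.gen V) =
        resTop A W ((1 - hI.gen V) * (1 - hI.gen (V ⊓ W))) := by
      have hW0 : resTop A W (hI.gen W) = 0 := hI.gen_mem W
      have := congrArg (resTop A W) h₂
      simp only [map_mul, map_sub, map_one, map_zero, hW0, sub_zero, mul_one] at this ⊢
      linear_combination this
    rw [act_of_resTop_eq F h₃, act_mul, h₁, map_zero]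
  intro V
  have one {W : Opens X} (h : W ≤ V) (s : F.val.obj (op W)) : act F W (1 - hI.gen V) s = s := by
    have h0 : resTop A W (hI.gen V) = 0 := hI.anti h (hI.gen_mem V)
    rw [act_of_resTop_eq F (r' := 1) (by rw [map_sub, h0, map_one, sub_zero]), map_one]
    rfl
  refine ⟨fun x => ?_, fun s hs => ?_⟩
  · change F.val.obj (op V) at x
    choose s hs using fun i => surj i (inf_le_right : V ⊓ U i ≤ U i)
      (F.res (homOfLE inf_le_left) x)
    -- Multiplying by `1 - gen V` acts as extension by zero off `V`: the lift of `x` is unchanged on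
    -- `V`, and the lifts become equal on overlaps because their differences vanish on `V`.
    let s' (i : ι) : F.val.obj (op (U i)) := act F (U i) (1 - hI.gen V) (s i)
    have hs' (i) : F.res (homOfLE (inf_le_right : V ⊓ U i ≤ U i)) (s' i) =
        F.res (homOfLE inf_le_left) x := by
      rw [res_act, hs, one inf_le_left]
    obtain ⟨y, hy⟩ := exists_section_of_cover F U ⊤ (fun _ => le_top) hU.ge s' fun i j => by
      rw [← sub_eq_zero]
      have key := ker i (W := U i ⊓ U j) inf_le_left V
        (F.res (homOfLE inf_le_left) (s' i) - F.res (homOfLE inf_le_right) (s' j)) (by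
          have hi := congrArg (F.res (homOfLE (le_inf inf_le_left (inf_le_right.trans inf_le_left) :
            V ⊓ (U i ⊓ U j) ≤ V ⊓ U i))) (hs' i)
          have hj := congrArg (F.res (homOfLE (le_inf inf_le_left
            (inf_le_right.trans inf_le_right) : V ⊓ (U i ⊓ U j) ≤ V ⊓ U j))) (hs' j)
          rw [res_res, res_res] at hi hj
          rw [map_sub, res_res, res_res, sub_eq_zero]
          exact hi.trans hj.symm)
      have hidem (i) : act F (U i) (1 - hI.gen V) (s' i) = s' i := by
        rw [← act_mul, (hI.isIdempotentElem_gen V).one_sub.eq]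
      rwa [map_sub, ← res_act, ← res_act, hidem, hidem] at key
    refine ⟨y, sections_ext_of_cover F (fun i => V ⊓ U i) V (fun _ => inf_le_left)
      (by rw [← inf_iSup_eq, hU, inf_top_eq]) fun i => ?_⟩
    rw [← hs', ← hy, res_res, res_res]
    rfl
  -- Vanishing is local, so `ker` on each cover member suffices; then `s = gen V • s` exhibits `s`
  -- as a multiple of a function vanishing on `V`.
  · have h0 : act F ⊤ (1 - hI.gen V) s = 0 := by
      refine sections_ext_of_cover F U ⊤ (fun _ => le_top) hU.ge fun i => ?_
      have key := ker i (W := U i) le_rfl V (F.res (homOfLE le_top) s) (by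
        have := congrArg (F.res (homOfLE (inf_le_left : V ⊓ U i ≤ V))) hs
        rw [map_zero, res_res] at this
        rw [res_res]
        exact this)
      rw [res_act, map_zero]
      exact key
    have h1 : s = act F ⊤ (hI.gen V) s := by
      rw [map_sub, map_one] at h0
      exact sub_eq_zero.1 h0
    rw [h1]
    refine (act_top F (hI.gen V) s).symm ▸ ?_
    exact Submodule.smul_mem_smul (hI.gen_mem V) trivial

end SplitSheaf

end TorsionCurve

/-! ### Quasi-coherent modules over a split sheaf of rings -/

namespace TorsionCurve

open SheafOfModules

section SplitSheaf

variable {X : TopCat.{u}} {A : Sheaf (Opens.grothendieckTopology X) CommRingCat.{u}}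

/-! ### The sheaf attached to a module of global sections -/

section Tilde

/-- The presheaf of quotients of a module by the multiples of the members of a family of ideals. -/
def quotientPresheaf {R : Type u} [CommRing R] {I : Opens X → Ideal R} (hI : Antitone I)
    (M : Type u) [AddCommGroup M] [Module R M] : (Opens X)ᵒᵖ ⥤ AddCommGrpCat.{u} where
  obj U := AddCommGrpCat.of (M ⧸ I U.unop • (⊤ : Submodule R M))
  map {U V} f := AddCommGrpCat.ofHom (Submodule.factor
    (Submodule.smul_mono (hI (leOfHom f.unop)) le_rfl)).toAddMonoidHom
  map_id U := by
    ext x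
    obtain ⟨x, rfl⟩ := Submodule.Quotient.mk_surjective _ x
    rfl
  map_comp f g := by
    ext x
    obtain ⟨x, rfl⟩ := Submodule.Quotient.mk_surjective _ x
    rfl

/-- `IsSplitFamily.exists_gluing` glues compatible classes, and `IsSplitFamily.mem_iSup_smul_top`
makes the result unique. -/
lemma isSheaf_quotientPresheaf [NoetherianSpace X] {R : Type u} [CommRing R]
    {I : Opens X → Ideal R} (hI : IsSplitFamily I) (M : Type u) [AddCommGroup M] [Module R M] :
    TopCat.Presheaf.IsSheaf (quotientPresheaf hI.anti M) := by
  refine (TopCat.Presheaf.isSheaf_iff_isSheafUniqueGluing _).mpr ?_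
  intro ι U sf hsf
  change ∀ i, M ⧸ I (U i) • (⊤ : Submodule R M) at sf
  choose m hm using fun i => Submodule.Quotient.mk_surjective _ (sf i)
  obtain ⟨n, hn⟩ := hI.exists_gluing U m fun i j => by
    have h := hsf i j
    rw [← hm i, ← hm j] at h
    exact (Submodule.Quotient.eq _).1 h
  refine ⟨Submodule.Quotient.mk n, fun i => ?_, fun s hs => ?_⟩
  · rw [← hm i]
    exact (Submodule.Quotient.eq _).2 (hn i)
  · obtain ⟨s, rfl⟩ := Submodule.Quotient.mk_surjective _ s
    refine (Submodule.Quotient.eq _).2 (hI.mem_iSup_smul_top U fun i => ?_)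
    have h := hs i
    rw [← hm i] at h
    have h' := (Submodule.Quotient.eq _).1 h
    have := sub_mem h' (hn i)
    rwa [sub_sub_sub_cancel_right] at this

variable (hA : IsSplit A) (M : Type u) [AddCommGroup M] [Module (Γ A) M]

/-- The action of the functions on an open set on the quotient of a module by the multiples of the
functions that vanish there. -/
noncomputable abbrev quotientModule (U : Opens X) :
    Module (A.obj.obj (op U)) (M ⧸ vanishingIdeal A U • (⊤ : Submodule (Γ A) M)) :=
  Module.compHom _ (show A.obj.obj (op U) →+* Γ A ⧸ vanishingIdeal A U from
    (RingHom.quotientKerEquivOfSurjective (hA.surjective U)).symm.toRingHom)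

lemma quotientModule_smul (U : Opens X) (r : Γ A) (m : M) :
    letI := quotientModule hA M U
    resTop A U r • (Submodule.Quotient.mk m : M ⧸ vanishingIdeal A U • (⊤ : Submodule (Γ A) M)) =
      Submodule.Quotient.mk (r • m) := by
  have h : (RingHom.quotientKerEquivOfSurjective (hA.surjective U)).symm (resTop A U r) =
      Ideal.Quotient.mk _ r := by
    rw [RingEquiv.symm_apply_eq]; rfl
  change (show Γ A ⧸ vanishingIdeal A U from
    (RingHom.quotientKerEquivOfSurjective (hA.surjective U)).symm (resTop A U r)) •
    (Submodule.Quotient.mk m : M ⧸ vanishingIdeal A U • (⊤ : Submodule (Γ A) M)) = _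
  rw [h]
  rfl

/-- The sheaf of modules over a split sheaf of rings associated to a module over the ring of global
functions. -/
noncomputable def tilde [NoetherianSpace X] : ShMod A :=
  letI (U : (Opens X)ᵒᵖ) : Module ((ringSheaf A).obj.obj U)
      ((quotientPresheaf hA.isSplitFamily.anti M).obj U) := quotientModule hA M U.unop
  { val := PresheafOfModules.ofPresheaf (quotientPresheaf hA.isSplitFamily.anti M)
      (fun U V f r m => by
        obtain ⟨r, rfl⟩ := hA.surjective U.unop r
        obtain ⟨m, rfl⟩ := Submodule.Quotient.mk_surjective _ m
        refine (congrArg ((quotientPresheaf hA.isSplitFamily.anti M).map f).hom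
          (quotientModule_smul hA M U.unop r m)).trans ?_
        refine (quotientModule_smul hA M V.unop r m).symm.trans ?_
        exact congrArg (fun x : A.obj.obj V => letI := quotientModule hA M V.unop
          x • (Submodule.Quotient.mk m : M ⧸ vanishingIdeal A V.unop • (⊤ : Submodule (Γ A) M)))
          (map_resTop A f.unop r).symm)
    isSheaf := isSheaf_quotientPresheaf hA.isSplitFamily M }

lemma vanishingIdeal_top : vanishingIdeal A ⊤ = ⊥ := by
  refine eq_bot_iff.2 fun r (hr : resTop A ⊤ r = 0) => ?_
  rwa [resTop_top] at hr

lemma isAssociated_tilde [NoetherianSpace X] :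
    isAssociated Limits.isTerminalTop (ringSheaf A) (tilde hA M) := fun U => by
  refine ⟨fun x => ?_, fun s hs => ?_⟩
  · change M ⧸ vanishingIdeal A U • (⊤ : Submodule (Γ A) M) at x
    obtain ⟨m, rfl⟩ := Submodule.Quotient.mk_surjective _ x
    exact ⟨(Submodule.Quotient.mk m : M ⧸ vanishingIdeal A ⊤ • (⊤ : Submodule (Γ A) M)), rfl⟩
  · obtain ⟨m, rfl⟩ := Submodule.Quotient.mk_surjective
      (vanishingIdeal A ⊤ • (⊤ : Submodule (Γ A) M)) s
    have hm : m ∈ vanishingIdeal A U • (⊤ : Submodule (Γ A) M) :=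
      (Submodule.Quotient.mk_eq_zero _).1 hs
    clear hs
    induction hm using Submodule.smul_induction_on' with
    | smul r hr x _ =>
      have h := quotientModule_smul hA M ⊤ r x
      rw [resTop_top] at h
      rw [← h]
      exact Submodule.smul_mem_smul (M := (tilde hA M).val.obj (op ⊤))
        (I := vanishing (ringSheaf A) (Limits.isTerminalTop.from U)) (r := r) (N := ⊤) hr trivial
    | add x _ y _ hx hy => exact add_mem hx hy

/-- The global sections of an associated sheaf. -/
noncomputable def tildeTopIso [NoetherianSpace X] :
    (ΓMod A).obj (tilde hA M) ≅ ModuleCat.of (Γ A) M :=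
  let e : (M ⧸ vanishingIdeal A ⊤ • (⊤ : Submodule (Γ A) M)) ≃+ M :=
    (Submodule.quotEquivOfEqBot _
      (by rw [vanishingIdeal_top, Submodule.bot_smul])).toAddEquiv
  letI := quotientModule hA M ⊤
  let l : (M ⧸ vanishingIdeal A ⊤ • (⊤ : Submodule (Γ A) M)) ≃ₗ[Γ A] M :=
    { e with
      map_smul' := fun r x => by
        obtain ⟨x, rfl⟩ := Submodule.Quotient.mk_surjective _ x
        have h := quotientModule_smul hA M ⊤ r x
        rw [resTop_top] at h
        exact (congrArg e h).trans rfl }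
  LinearEquiv.toModuleIso l

end Tilde

lemma IsSplit.isCoreflection_isAssociated [NoetherianSpace X] (hA : IsSplit A) :
    IsCoreflection (evaluation (ringSheaf A) (op ⊤))
      (isAssociated Limits.isTerminalTop (ringSheaf A)) :=
  SheafOfModules.isCoreflection_isAssociated _ (fun U => hA.surjective U)
    fun (M : ModuleCat.{u} (Γ A)) =>
      ⟨tilde hA M, isAssociated_tilde hA M, ⟨tildeTopIso hA M⟩⟩

lemma iSup_eq_top_of_coversTop {ι : Type u} (U : ι → Opens X)
    (hU : (Opens.grothendieckTopology X).CoversTop U) : ⨆ i, U i = ⊤ := by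
  refine eq_top_iff.2 fun x _ => ?_
  obtain ⟨V, f, ⟨i, ⟨g⟩⟩, hx⟩ := hU ⊤ x trivial
  exact Opens.mem_iSup.2 ⟨i, leOfHom g hx⟩

/-- Local presentations make the sheaf associated on each member of a cover, and being associated is
local. Conversely, an associated sheaf has a global presentation. -/
lemma IsSplit.isQuasicoherent_iff [NoetherianSpace X] (hA : IsSplit A) (F : ShMod A) :
    F.IsQuasicoherent ↔ isAssociated Limits.isTerminalTop (ringSheaf A) F := by
  have h := hA.isCoreflection_isAssociated
  have hR (U : Opens X) : Function.Surjective
    ((ringSheaf A).obj.map (Limits.isTerminalTop.from U).op) := hA.surjective U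
  constructor
  · rintro ⟨⟨q⟩⟩
    exact isAssociated_of_cover hA F q.X (iSup_eq_top_of_coversTop q.X q.coversTop) fun i =>
      isAssociated_of_presentation _
        (fun Z => surjective_map_of_isTerminal Limits.isTerminalTop hR
          (Over.mkIdTerminal.from Z).left)
        (isCoreflection_isAssociated_over Limits.isTerminalTop hR h (q.X i)) (q.presentation i)
  · intro hF
    obtain ⟨p⟩ := hF.nonempty_presentation Limits.isTerminalTop h
    exact p.isQuasicoherent

/-- Quasi-coherent modules over a split sheaf of rings on a Noetherian space are the same as modules
over the ring of global functions. -/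
lemma IsSplit.isCoreflection_ΓMod [NoetherianSpace X] (hA : IsSplit A) :
    IsCoreflection (ΓMod A) fun F => F.IsQuasicoherent := by
  have : (fun F : ShMod A => F.IsQuasicoherent) =
      isAssociated Limits.isTerminalTop (ringSheaf A) :=
    funext fun F => propext (hA.isQuasicoherent_iff F)
  rw [this]
  exact hA.isCoreflection_isAssociated

end SplitSheaf

end TorsionCurve

/-! ### Pushouts of split sheaves of rings -/

namespace TorsionCurve

section Pushout

variable {X : TopCat.{u}}

section Algebra

variable [NoetherianSpace X] {R : Type u} [CommRing R] {I : Opens X → Ideal R}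
  (hI : IsSplitFamily I) (B : Type u) [CommRing B] [Algebra R B]

/-- The sheaf of quotients of an algebra by the ideals generated by the members of a split family of
ideals. -/
def quotientSheaf : Sheaf (Opens.grothendieckTopology X) CommRingCat.{u} where
  obj :=
    { obj := fun U => CommRingCat.of (B ⧸ (I U.unop).map (algebraMap R B))
      map := fun f => CommRingCat.ofHom
        (Ideal.Quotient.factor (Ideal.map_mono (hI.anti (leOfHom f.unop))))
      map_id := fun U => by
        ext x
        rfl
      map_comp := fun f g => by
        ext x
        rfl }
  property := by
    have hmem (U : Opens X) (x : B) :
        x ∈ I U • (⊤ : Submodule R B) ↔ x ∈ (I U).map (algebraMap R B) := by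
      rw [Ideal.smul_top_eq_map, Submodule.restrictScalars_mem]
    refine (TopCat.Presheaf.isSheaf_iff_isSheafUniqueGluing _).mpr ?_
    intro ι U sf hsf
    change ∀ i, B ⧸ (I (U i)).map (algebraMap R B) at sf
    choose m hm using fun i => Ideal.Quotient.mk_surjective (sf i)
    obtain ⟨n, hn⟩ := hI.exists_gluing U m fun i j => by
      have h := hsf i j
      rw [← hm i, ← hm j] at h
      exact (hmem _ _).2 (Ideal.Quotient.eq.1 h)
    simp only [hmem] at hn
    refine ⟨Ideal.Quotient.mk _ n, fun i => ?_, fun s hs => ?_⟩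
    · rw [← hm i]
      exact Ideal.Quotient.eq.2 (hn i)
    · obtain ⟨s, rfl⟩ := Ideal.Quotient.mk_surjective s
      refine Ideal.Quotient.eq.2 ((hmem _ _).1 (hI.mem_iSup_smul_top U fun i => (hmem _ _).2 ?_))
      have h := hs i
      rw [← hm i] at h
      have := sub_mem (Ideal.Quotient.eq.1 h) (hn i)
      rwa [sub_sub_sub_cancel_right] at this

/-- The global section of the sheaf of quotients given by an element of the algebra. -/
def toQuotientSheaf : B →+* Γ (quotientSheaf hI B) := Ideal.Quotient.mk _

lemma toQuotientSheaf_surjective : Function.Surjective (toQuotientSheaf hI B) :=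
  Ideal.Quotient.mk_surjective

lemma resTop_toQuotientSheaf_eq_zero_iff (U : Opens X) (x : B) :
    resTop (quotientSheaf hI B) U (toQuotientSheaf hI B x) = 0 ↔
      x ∈ (I U).map (algebraMap R B) :=
  Ideal.Quotient.eq_zero_iff_mem

/-- The image in the algebra of an idempotent generator is again an idempotent generator of the
extended ideal. -/
lemma isSplit_quotientSheaf : IsSplit (quotientSheaf hI B) where
  surjective U x := by
    obtain ⟨x, rfl⟩ := Ideal.Quotient.mk_surjective x
    exact ⟨toQuotientSheaf hI B x, rfl⟩
  idem U := by
    refine ⟨toQuotientSheaf hI B (algebraMap R B (hI.gen U)),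
      ((hI.isIdempotentElem_gen U).map _).map _, Ideal.ext fun x => ?_⟩
    obtain ⟨x, rfl⟩ := toQuotientSheaf_surjective hI B x
    have hU : (I U).map (algebraMap R B) = Ideal.span {algebraMap R B (hI.gen U)} := by
      rw [hI.eq_span_gen U, Ideal.map_span, Set.image_singleton]
    refine (resTop_toQuotientSheaf_eq_zero_iff hI B U x).trans ?_
    rw [Ideal.mem_span_singleton']
    constructor
    · intro hx
      rw [hU, Ideal.mem_span_singleton'] at hx
      obtain ⟨a, rfl⟩ := hx
      exact ⟨toQuotientSheaf hI B a, (map_mul _ _ _).symm⟩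
    · rintro ⟨a, ha⟩
      rw [← resTop_toQuotientSheaf_eq_zero_iff hI B U x, ← ha, map_mul,
        (resTop_toQuotientSheaf_eq_zero_iff hI B U _).2 (Ideal.mem_map_of_mem _ (hI.gen_mem U)),
        mul_zero]

end Algebra

section Hom

variable {A : Sheaf (Opens.grothendieckTopology X) CommRingCat.{u}}
  {S : Sheaf (Opens.grothendieckTopology X) CommRingCat.{u}}

/-- Maps out of a split sheaf of rings are determined on global functions. -/
lemma IsSplit.hom_ext (hA : IsSplit A) {f g : A ⟶ S} (h : Γmap f = Γmap g) : f = g := by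
  ext U x
  obtain ⟨x, rfl⟩ := hA.surjective U.unop x
  refine (app_resTop f U.unop x).trans (Eq.trans ?_ (app_resTop g U.unop x).symm)
  rw [h]

/-- A map of rings of global functions out of a split sheaf of rings extends to a map of sheaves if
it respects the functions that vanish on the open sets. -/
lemma IsSplit.exists_hom (hA : IsSplit A) (φ : Γ A →+* Γ S)
    (hφ : ∀ U, ∀ r ∈ vanishingIdeal A U, resTop S U (φ r) = 0) : ∃ f : A ⟶ S, Γmap f = φ := by
  let ψ (U : Opens X) : A.obj.obj (op U) →+* S.obj.obj (op U) :=
    (resTop A U).liftOfSurjective (hA.surjective U) ⟨(resTop S U).comp φ, fun r hr => hφ U r hr⟩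
  have hψ (U : Opens X) (r : Γ A) : ψ U (resTop A U r) = resTop S U (φ r) :=
    RingHom.liftOfRightInverse_comp_apply _ _ _ _ _
  let f : A ⟶ S := ⟨{
    app := fun U => CommRingCat.ofHom (ψ U.unop)
    naturality := fun U V i => by
      ext x
      obtain ⟨x, rfl⟩ := hA.surjective U.unop x
      change ψ V.unop ((A.obj.map i.unop.op).hom (resTop A U.unop x)) =
        (S.obj.map i.unop.op).hom (ψ U.unop (resTop A U.unop x))
      rw [map_resTop, hψ, hψ, map_resTop] }⟩
  refine ⟨f, RingHom.ext fun r => ?_⟩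
  have := hψ ⊤ r
  rwa [resTop_top, resTop_top] at this

end Hom

open TensorProduct in
/-- The pushout of split sheaves of rings is split if the idempotents that belong to the open sets
kill the differences of the functions that agree there. -/
lemma isSplit_pushout [NoetherianSpace X]
    {O A K : Sheaf (Opens.grothendieckTopology X) CommRingCat.{u}} (a : O ⟶ A) (b : O ⟶ K)
    (hA : IsSplit A) (hK : IsSplit K)
    (hkill : ∀ (S : Sheaf (Opens.grothendieckTopology X) CommRingCat.{u}) (α : A ⟶ S)
      (β : K ⟶ S), a ≫ α = b ≫ β → ∀ (U : Opens X) (s : O.obj.obj (op U)) (x : Γ A) (y : Γ K),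
        resTop A U x = (a.hom.app (op U)).hom s → resTop K U y = (b.hom.app (op U)).hom s →
        Γmap α (1 - hA.isSplitFamily.gen U) * (Γmap α x - Γmap β y) = 0) :
    IsSplit (Limits.pushout a b) := by
  have hI := hA.isSplitFamily
  -- A section `s` of `O` over `U` need not be global, so its two images can be identified only on
  -- `U`: the relation is cut down by the idempotent `1 - gen U`. The resulting quotient sheaf will
  -- be shown to be the pushout.
  let J : Ideal (Γ A ⊗[ℤ] Γ K) := Ideal.span {z | ∃ (U : Opens X) (s : O.obj.obj (op U))
    (x : Γ A) (y : Γ K), resTop A U x = (a.hom.app (op U)).hom s ∧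
      resTop K U y = (b.hom.app (op U)).hom s ∧
      z = (1 - hI.gen U) ⊗ₜ 1 * (x ⊗ₜ 1 - 1 ⊗ₜ y)}
  let B := (Γ A ⊗[ℤ] Γ K) ⧸ J
  let : CommRing B := Ideal.Quotient.commRing J
  let iA : Γ A →+* B := (Ideal.Quotient.mk J).comp Algebra.TensorProduct.includeLeftRingHom
  let iK : Γ K →+* B := (Ideal.Quotient.mk J).comp
    (Algebra.TensorProduct.includeRight : Γ K →ₐ[ℤ] Γ A ⊗[ℤ] Γ K).toRingHom
  let : Algebra (Γ A) B := iA.toAlgebra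
  have hrel (U : Opens X) (s : O.obj.obj (op U)) (x : Γ A) (y : Γ K)
      (hx : resTop A U x = (a.hom.app (op U)).hom s)
      (hy : resTop K U y = (b.hom.app (op U)).hom s) :
      iA x - iK y ∈ (vanishingIdeal A U).map (algebraMap (Γ A) B) := by
    have h : iA (1 - hI.gen U) * (iA x - iK y) = 0 :=
      Ideal.Quotient.eq_zero_iff_mem.2 (Ideal.subset_span ⟨U, s, x, y, hx, hy, rfl⟩)
    have h' : iA x - iK y = (iA x - iK y) * iA (hI.gen U) := by
      rw [map_sub, map_one] at h
      linear_combination h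
    rw [h']
    exact Ideal.mul_mem_left _ _ (Ideal.mem_map_of_mem (algebraMap (Γ A) B) (hI.gen_mem U))
  let T' := quotientSheaf hI B
  let mk : B →+* Γ T' := toQuotientSheaf hI B
  have hmk (U : Opens X) (x : B) : resTop T' U (mk x) = 0 ↔
      x ∈ (vanishingIdeal A U).map (algebraMap (Γ A) B) :=
    resTop_toQuotientSheaf_eq_zero_iff hI B U x
  obtain ⟨i, hi⟩ := hA.exists_hom (S := T') (mk.comp iA) fun U r hr =>
    (hmk U _).2 (Ideal.mem_map_of_mem (algebraMap (Γ A) B) hr)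
  -- A function of `K` vanishing on `U` agrees there with the image of `s = 0`, so the relation with
  -- `x = 0` puts it in the ideal of `U`.
  obtain ⟨j, hj⟩ := hK.exists_hom (S := T') (mk.comp iK) fun U r hr => by
    refine (hmk U _).2 ?_
    have := hrel U 0 0 r (by simp) (by rw [map_zero]; exact hr)
    rwa [map_zero, zero_sub, neg_mem_iff] at this
  have hij : a ≫ i = b ≫ j := by
    ext U s
    obtain ⟨x, hx⟩ := hA.surjective U.unop ((a.hom.app U).hom s)
    obtain ⟨y, hy⟩ := hK.surjective U.unop ((b.hom.app U).hom s)
    change (i.hom.app U).hom ((a.hom.app U).hom s) = (j.hom.app U).hom ((b.hom.app U).hom s)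
    have h₁ := app_resTop i U.unop x
    have h₂ := app_resTop j U.unop y
    rw [hx, hi] at h₁
    rw [hy, hj] at h₂
    refine h₁.trans (Eq.trans ?_ h₂.symm)
    rw [← sub_eq_zero, ← map_sub]
    exact (hmk U.unop _).2 (hrel U.unop s x y hx hy)
  let p : Limits.pushout a b ⟶ T' := Limits.pushout.desc i j hij
  let T := Limits.pushout a b
  let α : A ⟶ T := Limits.pushout.inl a b
  let β : K ⟶ T := Limits.pushout.inr a b
  let q₀ : Γ A ⊗[ℤ] Γ K →+* Γ T :=
    (Algebra.TensorProduct.productMap (Γmap α).toIntAlgHom (Γmap β).toIntAlgHom).toRingHom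
  have hq₀ (x : Γ A) (y : Γ K) : q₀ (x ⊗ₜ y) = Γmap α x * Γmap β y :=
    Algebra.TensorProduct.productMap_apply_tmul _ _ _ _
  -- This is where `hkill` enters: the relations in `J` already hold in the pushout.
  let q₁ : B →+* Γ T := Ideal.Quotient.lift J q₀ fun z hz => by
    change z ∈ RingHom.ker q₀
    revert z
    change J ≤ RingHom.ker q₀
    rw [Ideal.span_le]
    rintro _ ⟨U, s, x, y, hx, hy, rfl⟩
    change q₀ _ = 0
    rw [map_mul, map_sub, hq₀, hq₀, hq₀, map_one, map_one, mul_one, mul_one, one_mul]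
    exact hkill T α β Limits.pushout.condition U s x y hx hy
  have hqA (x : Γ A) : q₁ (iA x) = Γmap α x := by
    change q₀ (x ⊗ₜ 1) = _
    rw [hq₀, map_one, mul_one]
  have hqK (y : Γ K) : q₁ (iK y) = Γmap β y := by
    change q₀ (1 ⊗ₜ y) = _
    rw [hq₀, map_one, one_mul]
  have hq₁ (U : Opens X) (x : B) (hx : x ∈ (vanishingIdeal A U).map (algebraMap (Γ A) B)) :
      resTop T U (q₁ x) = 0 := by
    revert x
    change _ ≤ RingHom.ker ((resTop T U).comp q₁)
    rw [Ideal.map_le_iff_le_comap]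
    intro r hr
    change resTop T U (q₁ (iA r)) = 0
    have hr' : resTop A U r = 0 := hr
    rw [hqA, ← app_resTop, hr', map_zero]
  obtain ⟨q, hq⟩ := (isSplit_quotientSheaf hI B).exists_hom (S := T)
    (Ideal.Quotient.lift _ q₁ fun x hx => by
      have := hq₁ ⊤ x hx
      rwa [resTop_top] at this) fun U r hr => by
    obtain ⟨x, rfl⟩ := toQuotientSheaf_surjective hI B r
    exact hq₁ U x ((hmk U x).1 hr)
  have hq' (x : B) : Γmap q (mk x) = q₁ x := by rw [hq]; rfl
  have hpA (x : Γ A) : Γmap p (Γmap α x) = mk (iA x) := by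
    have h : α ≫ p = i := Limits.pushout.inl_desc _ _ _
    have := congr(Γmap $h x)
    rwa [hi] at this
  have hpK (y : Γ K) : Γmap p (Γmap β y) = mk (iK y) := by
    have h : β ≫ p = j := Limits.pushout.inr_desc _ _ _
    have := congr(Γmap $h y)
    rwa [hj] at this
  have hpq : p ≫ q = 𝟙 T := by
    refine Limits.pushout.hom_ext ?_ ?_
    · refine hA.hom_ext (RingHom.ext fun x => ?_)
      change Γmap q (Γmap p (Γmap α x)) = Γmap α x
      rw [hpA, hq', hqA]
    · refine hK.hom_ext (RingHom.ext fun x => ?_)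
      change Γmap q (Γmap p (Γmap β x)) = Γmap β x
      rw [hpK, hq', hqK]
  have hqp : q ≫ p = 𝟙 T' := by
    refine (isSplit_quotientSheaf hI B).hom_ext (RingHom.ext fun x => ?_)
    obtain ⟨x, rfl⟩ := toQuotientSheaf_surjective hI B x
    change Γmap p (Γmap q (mk x)) = mk x
    rw [hq']
    obtain ⟨x, rfl⟩ := Ideal.Quotient.mk_surjective x
    induction x using TensorProduct.induction_on with
    | zero => simp only [map_zero]
    | tmul x y =>
      have : Ideal.Quotient.mk J (x ⊗ₜ y) = iA x * iK y := by
        change _ = Ideal.Quotient.mk J (x ⊗ₜ 1) * Ideal.Quotient.mk J (1 ⊗ₜ y)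
        rw [← map_mul, Algebra.TensorProduct.tmul_mul_tmul, mul_one, one_mul]
      rw [this, map_mul, map_mul, map_mul, hqA, hqK, hpA, hpK]
    | add x y hx hy => simp only [map_add, hx, hy]
  exact (isSplit_quotientSheaf hI B).of_iso ⟨q, p, hqp, hpq⟩

end Pushout

end TorsionCurve

/-! ### Points and functions on the curve -/

namespace TorsionCurve

open Polynomial WeierstrassCurve.Affine

/-! ### Closed points, finite denominators and two linear forms -/

section Points

variable {k : Type u} [Field k] (W : WeierstrassCurve k)

instance : Module.Finite k[X] (CoordRing W) := .of_basis (CoordinateRing.basis W.toAffine)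

instance : IsNoetherianRing (CoordRing W) := IsNoetherianRing.of_finite k[X] _

/-- The coordinate ring is finite over `k[X]`, so a prime containing `r ≠ 0` contracts to a
non-zero, hence maximal, ideal and is itself maximal. Maximal ideals containing `r` are thus minimal
primes over it, finite in number by Noetherianity. -/
lemma finite_setOf_mem_maximalSpectrum {r : CoordRing W} (hr : r ≠ 0) :
    {m : MaximalSpectrum (CoordRing W) | r ∈ m.asIdeal}.Finite := by
  refine Set.Finite.of_finite_image (f := MaximalSpectrum.asIdeal)
    (((Ideal.span {r}).finite_minimalPrimes_of_isNoetherianRing).subset ?_)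
    (fun m _ m' _ h => MaximalSpectrum.ext h)
  rintro _ ⟨m, hm, rfl⟩
  refine ⟨⟨m.isMaximal.isPrime, (Ideal.span_singleton_le_iff_mem _).2 hm⟩, ?_⟩
  rintro q ⟨hq, hrq⟩ hqm
  have hrq' : r ∈ q := (Ideal.span_singleton_le_iff_mem _).1 hrq
  have hne : q.comap (algebraMap k[X] (CoordRing W)) ≠ ⊥ :=
    Ideal.comap_ne_bot_of_integral_mem hr hrq' (Algebra.IsIntegral.isIntegral r)
  have hmax : (q.comap (algebraMap k[X] (CoordRing W))).IsMaximal :=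
    Ideal.IsPrime.isMaximal (Ideal.comap_isPrime _ _) hne
  have := Ideal.isMaximal_of_isIntegral_of_isMaximal_comap q hmax
  exact (this.eq_of_le m.isMaximal.ne_top hqm).ge

/-- Some point lies over each value of the coordinate `x` in the infinite field `k`, and different
values give different points. -/
instance [CharZero k] : Infinite (Pt W) := by
  have h (a : k) : ∃ m : MaximalSpectrum (CoordRing W),
      algebraMap k[X] (CoordRing W) (X - C a) ∈ m.asIdeal := by
    have hmax : (Ideal.span {X - C a}).IsMaximal :=
      PrincipalIdealRing.isMaximal_of_irreducible (irreducible_X_sub_C a)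
    obtain ⟨Q, hQ, hQ'⟩ := Ideal.exists_ideal_over_maximal_of_isIntegral
      (S := CoordRing W) (Ideal.span {X - C a}) (by
        rw [(RingHom.injective_iff_ker_eq_bot (algebraMap k[X] (CoordRing W))).1
          (FaithfulSMul.algebraMap_injective _ _)]
        exact bot_le)
    refine ⟨⟨Q, hQ⟩, ?_⟩
    have : X - C a ∈ Q.comap (algebraMap k[X] (CoordRing W)) := by
      rw [hQ']
      exact Ideal.mem_span_singleton_self _
    exact this
  choose m hm using h
  refine Infinite.of_injective (fun a => (some (m a) : Option _)) fun a b hab => ?_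
  by_contra hne
  have hmab : m a = m b := Option.some_injective _ hab
  have h₁ := hm a
  rw [hmab] at h₁
  have h₂ := sub_mem (hm b) h₁
  rw [← map_sub, sub_sub_sub_cancel_left, ← C_sub] at h₂
  refine (m b).isMaximal.ne_top (Ideal.eq_top_of_isUnit_mem _ h₂ ?_)
  exact (isUnit_C.2 (sub_ne_zero.2 hne).isUnit).map _

/-- The ideal of the polynomials in the homogeneous coordinates that vanish at a point. -/
def vanishingForms (x : Pt W) : Ideal (MvPolynomial (Fin 3) k) where
  carrier := {q | VanishesAt W x q}
  zero_mem' := vanishesAt_zero W x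
  add_mem' := vanishesAt_add W
  smul_mem' _ _ h := (vanishesAt_mul W).2 (Or.inr h)

lemma not_vanishesAt_pow {x : Pt W} {q : MvPolynomial (Fin 3) k} (hq : ¬ VanishesAt W x q)
    (n : ℕ) : ¬ VanishesAt W x (q ^ n) := by
  induction n with
  | zero => simpa using not_vanishesAt_one W x
  | succ n ih => rw [pow_succ, vanishesAt_mul]; tauto

/-- A function regular on a part of the complement of a hyperplane section is locally a quotient of
two functions regular on the whole complement, with finitely many denominators in total. -/
lemma exists_denominators {ℓ : MvPolynomial (Fin 3) k} (hℓ : ℓ.IsHomogeneous 1)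
    (hℓ' : formValue W ℓ ≠ 0) {V : Set (Pt W)} {f : FunField W}
    (hf : ∀ x ∈ V, f ∈ localRing W x) :
    ∃ t : Finset (FunField W),
      (∀ g ∈ t, ∀ x, ¬ VanishesAt W x ℓ → g ∈ localRing W x ∧ g * f ∈ localRing W x) ∧
      ∀ x ∈ V, ∃ g ∈ t, g ≠ 0 ∧ g⁻¹ ∈ localRing W x := by
  classical
  -- The ideal generated by all denominators of `f` is generated by finitely many of them. If all of
  -- these vanished at a point, so would every denominator of `f`.
  let Q : Set (MvPolynomial (Fin 3) k) := {q | ∃ p d, p.IsHomogeneous d ∧ q.IsHomogeneous d ∧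
    formValue W q ≠ 0 ∧ f = formValue W p / formValue W q}
  obtain ⟨s, hsQ, hs⟩ := (Submodule.fg_span_iff_fg_span_finset_subset Q).1
    (IsNoetherian.noetherian (R := MvPolynomial (Fin 3) k) (Submodule.span _ Q))
  have hdeg {q : MvPolynomial (Fin 3) k} {d : ℕ} (hq : q.IsHomogeneous d)
      (hq' : formValue W q ≠ 0) : q.totalDegree = d :=
    hq.totalDegree (fun h => hq' (by rw [h, map_zero]))
  -- Dividing a denominator `q` by the power of `ℓ` of the same degree gives a function `g` regular
  -- off `ℓ = 0`, with `g * f = p / ℓ ^ d` regular there too.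
  refine ⟨s.image fun q => formValue W q / formValue W ℓ ^ q.totalDegree, ?_, ?_⟩
  · intro g hg x hx
    obtain ⟨q, hq, rfl⟩ := Finset.mem_image.1 hg
    obtain ⟨p, d, hp, hqd, hq0, hf'⟩ := hsQ hq
    rw [hdeg hqd hq0]
    have hℓd : (ℓ ^ d).IsHomogeneous d := by simpa using hℓ.pow d
    have hd : formValue W (ℓ ^ d) ≠ 0 := by rw [map_pow]; exact pow_ne_zero _ hℓ'
    refine ⟨⟨q, ℓ ^ d, ⟨d, hqd, hℓd⟩, not_vanishesAt_pow W hx d, hd, by rw [map_pow]⟩,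
      ⟨p, ℓ ^ d, ⟨d, hp, hℓd⟩, not_vanishesAt_pow W hx d, hd, ?_⟩⟩
    rw [hf', map_pow, div_mul_div_comm, mul_comm (formValue W q), mul_div_mul_right _ _ hq0]
  · intro x hx
    obtain ⟨p, q, ⟨d, hp, hq⟩, hqx, hq0, hf'⟩ := hf x hx
    have hqQ : q ∈ Submodule.span (MvPolynomial (Fin 3) k) Q :=
      Submodule.subset_span ⟨p, d, hp, hq, hq0, hf'⟩
    have : ∃ q' ∈ s, ¬ VanishesAt W x q' := by
      by_contra! hcon
      have hle : Submodule.span (MvPolynomial (Fin 3) k) (s : Set _) ≤ vanishingForms W x :=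
        Submodule.span_le.2 hcon
      exact hqx (hle (hs ▸ hqQ))
    obtain ⟨q', hq's, hq'x⟩ := this
    obtain ⟨p', d', hp', hq'd, hq'0, -⟩ := hsQ hq's
    refine ⟨_, Finset.mem_image_of_mem _ hq's, div_ne_zero hq'0 (pow_ne_zero _ hℓ'), ?_⟩
    rw [hdeg hq'd hq'0]
    exact ⟨ℓ ^ d', q', ⟨d', by simpa using hℓ.pow d', hq'd⟩, hq'x, hq'0, by rw [inv_div, map_pow]⟩

/-- The linear form that cuts out the point at infinity, with multiplicity three. -/
noncomputable def infinityForm (k : Type u) [Field k] : MvPolynomial (Fin 3) k := MvPolynomial.X 2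

/-- The linear form that cuts out the points of order two. -/
noncomputable def twoTorsionForm : MvPolynomial (Fin 3) k :=
  MvPolynomial.C 2 * MvPolynomial.X 1 + MvPolynomial.C W.a₁ * MvPolynomial.X 0 +
    MvPolynomial.C W.a₃ * MvPolynomial.X 2

lemma isHomogeneous_twoTorsionForm : (twoTorsionForm W).IsHomogeneous 1 := by
  refine ((?_ : MvPolynomial.IsHomogeneous _ 1).add ?_).add ?_ <;>
  exact (MvPolynomial.isHomogeneous_C_mul_X _ _)

/-- The function `2y + a₁x + a₃`. -/
noncomputable def twoTorsionFun : CoordRing W :=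
  2 * yCoord W + algebraMap k _ W.a₁ * xCoord W + algebraMap k _ W.a₃

/-- Its coefficient of `y` in the basis `1, y` over `k[X]` is `2`. -/
lemma twoTorsionFun_ne_zero [CharZero k] : twoTorsionFun W ≠ 0 := by
  intro h
  have h' : (C W.a₁ * X + C W.a₃ : k[X]) • (1 : W.toAffine.CoordinateRing) +
      (C 2 : k[X]) • CoordinateRing.mk W.toAffine X = 0 := by
    rw [← h, Algebra.smul_def, Algebra.smul_def, map_add, map_mul]
    have h2 : algebraMap k[X] (CoordRing W) (C 2) = 2 := by
      rw [map_ofNat, map_ofNat]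
    rw [h2, mul_one]
    simp only [twoTorsionFun]
    have hx : algebraMap k[X] (CoordRing W) X = xCoord W := rfl
    have hc (a : k) : algebraMap k[X] (CoordRing W) (C a) = algebraMap k (CoordRing W) a := rfl
    rw [hx, hc, hc]
    change _ + 2 * yCoord W = _
    ring
  have := (CoordinateRing.smul_basis_eq_zero h').2
  rw [C_eq_zero] at this
  exact two_ne_zero this

lemma aeval_twoTorsionForm : MvPolynomial.aeval ![xCoord W, yCoord W, 1] (twoTorsionForm W) =
    twoTorsionFun W := by
  simp [twoTorsionForm, twoTorsionFun, map_ofNat (algebraMap k (CoordRing W)) 2]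

lemma formValue_twoTorsionForm : formValue W (twoTorsionForm W) =
    algebraMap _ _ (twoTorsionFun W) := by
  have (a : k) : algebraMap k (FunField W) a =
    algebraMap (CoordRing W) (FunField W) (algebraMap k (CoordRing W) a) :=
    IsScalarTower.algebraMap_apply _ _ _ _
  simp [formValue, twoTorsionForm, twoTorsionFun, this, map_ofNat (algebraMap k (CoordRing W)) 2]

lemma vanishesAt_twoTorsionForm [CharZero k] {x : Pt W} (hx : VanishesAt W x (twoTorsionForm W)) :
    ∃ m, x = some m ∧ twoTorsionFun W ∈ m.asIdeal := by
  cases x with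
  | none => simp [VanishesAt, twoTorsionForm] at hx
  | some m => exact ⟨m, rfl, by rwa [VanishesAt, aeval_twoTorsionForm] at hx⟩

lemma vanishesAt_infinityForm {x : Pt W} (hx : VanishesAt W x (infinityForm k)) : x = none := by
  cases x with
  | none => rfl
  | some m =>
    exfalso
    simp only [VanishesAt, infinityForm, MvPolynomial.aeval_X] at hx
    exact m.isMaximal.ne_top ((Ideal.eq_top_iff_one _).2 hx)

end Points

/-! ### Noetherianity, intersections of open sets, and two basic open sets -/

section Topology

variable {k : Type u} [Field k] (W : WeierstrassCurve k) [W.IsElliptic]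

lemma finite_compl_of_mem {U : Opens (Ctp W)} {x : Pt W} (hx : x ∈ U) :
    {y : Pt W | y ∉ U}.Finite := by
  rcases U.isOpen with h | ⟨h, -⟩
  · have hx' : x ∈ U.carrier := hx
    rw [show U.carrier = ∅ from h] at hx'
    exact hx'.elim
  · exact h

/-- One non-empty member of a cover misses only finitely many points, each of which needs at most
one further member. -/
instance : NoetherianSpace (Ctp W) := by
  rw [noetherianSpace_iff_opens]
  intro U
  refine isCompact_of_finite_subcover fun {ι} V hV hUV => ?_
  classical
  by_cases hU : ∃ x, x ∈ U
  · obtain ⟨x, hx⟩ := hU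
    obtain ⟨i, hi⟩ := Set.mem_iUnion.1 (hUV hx)
    have hfin := finite_compl_of_mem W (U := ⟨V i, hV i⟩) hi
    have hex (y : Pt W) : ∃ j, y ∈ U → y ∈ V j := by
      by_cases hy : y ∈ U
      · obtain ⟨j, hj⟩ := Set.mem_iUnion.1 (hUV hy)
        exact ⟨j, fun _ => hj⟩
      · exact ⟨i, fun h => (hy h).elim⟩
    choose c hc using hex
    refine ⟨insert i (hfin.toFinset.image c), fun y hy => ?_⟩
    by_cases hyi : y ∈ V i
    · exact Set.mem_biUnion (Finset.mem_coe.2 (Finset.mem_insert_self _ _)) hyi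
    · exact Set.mem_biUnion (Finset.mem_coe.2 (Finset.mem_insert_of_mem
        (Finset.mem_image_of_mem c (hfin.mem_toFinset.2 hyi)))) (hc y hy)
  · exact ⟨∅, fun y hy => (hU ⟨y, hy⟩).elim⟩

lemma exists_mem_inf [CharZero k] {U V : Opens (Ctp W)} {x y : Pt W} (hx : x ∈ U) (hy : y ∈ V) :
    ∃ z, z ∈ U ∧ z ∈ V := by
  obtain ⟨z, hz⟩ := ((finite_compl_of_mem W hx).union (finite_compl_of_mem W hy)).exists_notMem
  exact ⟨z, not_not.1 fun h => hz (Or.inl h), not_not.1 fun h => hz (Or.inr h)⟩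

/-- Non-empty open sets have finite complement in an infinite set, so neighbourhoods on which the
two values are taken share a point. -/
lemma isLocConst_eq [CharZero k] {U : Opens (Ctp W)} {B : Type u} {s : {x : Ctp W // x ∈ U} → B}
    (hs : IsLocConst s) (x y : {x : Ctp W // x ∈ U}) : s x = s y := by
  obtain ⟨V, hV, h⟩ := hs x
  obtain ⟨V', hV', h'⟩ := hs y
  obtain ⟨z, hz, hz'⟩ := exists_mem_inf W (U := U ⊓ V) (V := V') ⟨x.2, hV⟩ hV'
  rw [← h ⟨z, hz.1⟩ hz.2, h' ⟨z, hz.1⟩ hz']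

lemma constSection_bijective [CharZero k] (B : Type u) [CommRing B] :
    Function.Bijective (constSection (Ctp W) B) := by
  let o : Ctp W := (none : Option (MaximalSpectrum (CoordRing W)))
  refine ⟨fun a b h => ?_, fun s => ?_⟩
  · exact congrFun (congrArg Subtype.val h) ⟨o, trivial⟩
  · exact ⟨s.1 ⟨o, trivial⟩, Subtype.ext (funext fun x => isLocConst_eq W s.2 _ _)⟩

/-- The complement of a finite set of points of finite order. -/
def formOpen (ℓ : MvPolynomial (Fin 3) k) (hfin : {x : Pt W | VanishesAt W x ℓ}.Finite)
    (htors : ∀ x, VanishesAt W x ℓ → IsTorsion W x) : Opens (Ctp W) where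
  carrier := {x : Pt W | ¬ VanishesAt W x ℓ}
  is_open' := Or.inr ⟨hfin.subset fun _ hx => not_not.1 hx, fun x hx => htors x (not_not.1 hx)⟩

/-- Negation sends `y` to `-y - a₁x - a₃`, so vanishing of `2y + a₁x + a₃` makes the point its own
negative. -/
lemma isTorsion_of_twoTorsionFun_mem {m : MaximalSpectrum (CoordRing W)}
    (hm : twoTorsionFun W ∈ m.asIdeal) : IsTorsion W (some m) := by
  classical
  have h : algebraMap (CoordRing W) m.asIdeal.ResidueField (twoTorsionFun W) = 0 := by
    rwa [Ideal.algebraMap_residueField_eq_zero]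
  have hneg : -tautologicalPoint W m = tautologicalPoint W m := by
    rw [tautologicalPoint, Point.neg_some]
    congr 1
    simp only [twoTorsionFun, map_add, map_mul, map_ofNat, ← IsScalarTower.algebraMap_apply] at h
    simp only [negY]
    change -_ - algebraMap k _ W.a₁ * _ - algebraMap k _ W.a₃ = _
    linear_combination -h
  have h2 : 2 • tautologicalPoint W m = 0 := by
    rw [two_nsmul]
    nth_rw 1 [← hneg]
    exact neg_add_cancel _
  refine (addOrderOf_pos_iff.2 (isOfFinAddOrder_iff_nsmul_eq_zero.2 ⟨2, two_pos, ?_⟩)).ne'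
  convert h2

/-- The affine curve. -/
noncomputable def affineOpen : Opens (Ctp W) :=
  formOpen W (infinityForm k)
    ((Set.finite_singleton (none : Pt W)).subset fun _ hx => vanishesAt_infinityForm W hx)
    (fun x hx => by
      rw [vanishesAt_infinityForm W hx]
      exact one_ne_zero)

/-- The complement of the points of order two. -/
noncomputable def twoTorsionOpen [CharZero k] : Opens (Ctp W) :=
  formOpen W (twoTorsionForm W)
    (((finite_setOf_mem_maximalSpectrum W (twoTorsionFun_ne_zero W)).image some).subset
      fun _ hx => by
        obtain ⟨m, rfl, hm⟩ := vanishesAt_twoTorsionForm W hx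
        exact ⟨m, hm, rfl⟩)
    (fun x hx => by
      obtain ⟨m, rfl, hm⟩ := vanishesAt_twoTorsionForm W hx
      exact isTorsion_of_twoTorsionFun_mem W hm)

end Topology

end TorsionCurve

/-! ### The sheaves of rings of the fork are split -/

namespace TorsionCurve

section Split

variable {k : Type u} [Field k] (W : WeierstrassCurve k) [W.IsElliptic]

lemma mem_top (x : Pt W) : x ∈ (⊤ : Opens (Ctp W)) := trivial

/-- At infinity, `[0 : 1 : 0]`, the form `2Y + a₁X + a₃Z` takes the value `2`, which is non-zero. -/
lemma affineOpen_sup_twoTorsionOpen [CharZero k] : affineOpen W ⊔ twoTorsionOpen W = ⊤ := by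
  refine top_le_iff.1 fun x _ => ?_
  by_cases hx : VanishesAt W x (infinityForm k)
  · refine Or.inr fun hx' => ?_
    obtain ⟨m, hm, -⟩ := vanishesAt_twoTorsionForm W hx'
    rw [vanishesAt_infinityForm W hx] at hm
    cases hm
  · exact Or.inl hx

/-- Sections over a non-empty open set are constants, so the idempotent is `0` there and `1` for the
empty set. -/
lemma isSplit_constSheaf [CharZero k] (B : Type u) [CommRing B] :
    IsSplit (constSheaf (Ctp W) B) := by
  refine ⟨fun U s => ?_, fun U => ?_⟩
  · by_cases hU : ∃ x : Ctp W, x ∈ U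
    · obtain ⟨x, hx⟩ := hU
      exact ⟨constSection _ B (s.1 ⟨x, hx⟩), Subtype.ext (funext fun y => isLocConst_eq W s.2 _ _)⟩
    · exact ⟨0, Subtype.ext (funext fun y => (hU ⟨y.1, y.2⟩).elim)⟩
  · by_cases hU : ∃ x : Ctp W, x ∈ U
    · obtain ⟨x, hx⟩ := hU
      refine ⟨0, .zero, ?_⟩
      rw [Ideal.span_singleton_eq_bot.2 rfl, eq_bot_iff]
      intro r hr
      refine Subtype.ext (funext fun y => ?_)
      exact (isLocConst_eq W r.2 y ⟨x, trivial⟩).trans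
        (congrFun (congrArg Subtype.val hr) ⟨x, hx⟩)
    · refine ⟨1, .one, ?_⟩
      rw [Ideal.span_singleton_one, eq_top_iff]
      intro r _
      exact Subtype.ext (funext fun y => (hU ⟨y.1, y.2⟩).elim)

variable {W} in
/-- The component of a section of the completion at a point of finite order. -/
def completionEval {U : Opens (Ctp W)} {n : ℕ+} (i : ExactOrder W n) (hi : i.1 ∈ U) :
    (completionSheaf W).obj.obj (op U) →+* completedLocalRing W i.1 where
  toFun s := (s n).1 ⟨i, hi⟩
  map_one' := rfl
  map_mul' _ _ := rfl
  map_zero' := rfl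
  map_add' _ _ := rfl

variable {W} in
lemma completion_ext {U : Opens (Ctp W)} {s t : (completionSheaf W).obj.obj (op U)}
    (h : ∀ (n : ℕ+) (i : ExactOrder W n) (hi : i.1 ∈ U),
      completionEval i hi s = completionEval i hi t) : s = t :=
  funext fun n => Subtype.ext (funext fun i => h n i.1 i.2)

variable {W} in
/-- The section of the completion with given components. -/
def completionMk (U : Opens (Ctp W)) (c : ∀ (n : ℕ+) (i : ExactOrder W n), i.1 ∈ U →
    completedLocalRing W i.1) : (completionSheaf W).obj.obj (op U) :=
  fun n => ⟨fun i => c n i.1 i.2, trivial⟩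

lemma completionEval_completionMk {U : Opens (Ctp W)} (c : ∀ (n : ℕ+) (i : ExactOrder W n),
    i.1 ∈ U → completedLocalRing W i.1) {n : ℕ+} (i : ExactOrder W n) (hi : i.1 ∈ U) :
    completionEval i hi (completionMk U c) = c n i hi := rfl

lemma completionEval_resTop {U : Opens (Ctp W)} {n : ℕ+} (i : ExactOrder W n) (hi : i.1 ∈ U)
    (r : Γ (completionSheaf W)) :
    completionEval i hi (resTop (completionSheaf W) U r) =
      completionEval (U := ⊤) i (mem_top W i.1) r := rfl

lemma completionEval_toCompletion {U : Opens (Ctp W)} {n : ℕ+} (i : ExactOrder W n)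
    (hi : i.1 ∈ U) (s : (structureSheaf W).obj.obj (op U)) :
    completionEval i hi (((toCompletion W).hom.app (op U)).hom s) =
      algebraMap (localRing W i.1) (completedLocalRing W i.1)
        ⟨s.1 ⟨i.1, hi⟩, s.2.2 ⟨i.1, hi⟩⟩ := rfl

open Classical in
-- Sections are families indexed by torsion points: extend by zero to lift them, and take the
-- idempotent that is `0` on `U` and `1` off it.
lemma isSplit_completionSheaf : IsSplit (completionSheaf W) := by
  refine ⟨fun U s => ⟨completionMk ⊤ fun n i _ => if h : i.1 ∈ U then completionEval i h s else 0,
    completion_ext fun n i hi => ?_⟩, fun U => ⟨completionMk ⊤ fun n i _ =>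
      if i.1 ∈ U then 0 else 1, completion_ext fun n i hi => ?_, Ideal.ext fun r => ?_⟩⟩
  · rw [completionEval_resTop, completionEval_completionMk, dif_pos hi]
  · rw [map_mul, completionEval_completionMk]
    split_ifs
    · exact mul_zero _
    · exact mul_one _
  · rw [Ideal.mem_span_singleton']
    constructor
    · intro (hr : resTop _ U r = 0)
      refine ⟨r, completion_ext fun n i hi => ?_⟩
      rw [map_mul, completionEval_completionMk]
      split_ifs with h
      · rw [mul_zero, ← completionEval_resTop W i h, hr, map_zero]
      · exact mul_one _
    · rintro ⟨a, rfl⟩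
      refine completion_ext (t := 0) fun n i hi => ?_
      rw [completionEval_resTop, map_mul, completionEval_completionMk, if_pos hi, mul_zero,
        map_zero]

open Classical in
-- The generator is obtained by choice, but the ideal forces its components: it vanishes on `U`, and
-- off `U` it must fix the indicator of the complement.
lemma completionEval_one_sub_gen (U : Opens (Ctp W)) {n : ℕ+} (i : ExactOrder W n) :
    completionEval (U := ⊤) i (mem_top W i.1) (1 - (isSplit_completionSheaf W).isSplitFamily.gen U) =
      if i.1 ∈ U then 1 else 0 := by
  set hI := (isSplit_completionSheaf W).isSplitFamily
  split_ifs with h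
  · have h0 : resTop _ U (hI.gen U) = 0 := hI.gen_mem U
    rw [map_sub, map_one, ← completionEval_resTop W i h, h0, map_zero, sub_zero]
  · let r : Γ (completionSheaf W) := completionMk ⊤ fun n i _ => if i.1 ∈ U then 0 else 1
    have hre {n : ℕ+} (i : ExactOrder W n) :
        completionEval i (mem_top W i.1) r = if i.1 ∈ U then 0 else 1 := rfl
    have hr : r ∈ vanishingIdeal (completionSheaf W) U := by
      refine completion_ext (t := 0) fun n i hi => ?_
      rw [completionEval_resTop, hre, if_pos hi, map_zero]
    rw [hI.eq_span_gen U, Ideal.mem_span_singleton'] at hr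
    obtain ⟨a, ha⟩ := hr
    have h0 : (1 - hI.gen U) * r = 0 := by
      rw [← ha, mul_left_comm, sub_mul, one_mul, (hI.isIdempotentElem_gen U).eq, sub_self, mul_zero]
    have h1 := congrArg (completionEval (U := ⊤) i (mem_top W i.1)) h0
    rwa [map_mul, hre, if_neg h, mul_one, map_zero] at h1

/-- If a sheaf of rings `S` identifies regular functions with their expansions, then it identifies
a meromorphic function that is regular on `U` with its expansion at the points of `U`; here this is
shown on the complement `D` of a hyperplane section. -/
lemma resTop_gen_mul_sub_eq_zero [CharZero k] {S : Sheaf (tp W) CommRingCat.{u}}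
    {α : completionSheaf W ⟶ S} {β : meromorphicSheaf W ⟶ S}
    (hαβ : toCompletion W ≫ α = toMeromorphic W ≫ β) {U : Opens (Ctp W)}
    {s : (structureSheaf W).obj.obj (op U)} {x : Γ (completionSheaf W)}
    {y : Γ (meromorphicSheaf W)}
    (hx : resTop (completionSheaf W) U x = ((toCompletion W).hom.app (op U)).hom s)
    (hy : resTop (meromorphicSheaf W) U y = ((toMeromorphic W).hom.app (op U)).hom s)
    {ℓ : MvPolynomial (Fin 3) k} (hℓ : ℓ.IsHomogeneous 1) (hℓ' : formValue W ℓ ≠ 0)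
    {D : Opens (Ctp W)} (hD : ∀ x : Pt W, x ∈ D → ¬ VanishesAt W x ℓ) :
    resTop S D (Γmap α (1 - (isSplit_completionSheaf W).isSplitFamily.gen U) *
      (Γmap α x - Γmap β y)) = 0 := by
  classical
  set e := 1 - (isSplit_completionSheaf W).isSplitFamily.gen U with he
  -- The section `y` is constant, so it may be read off at any point; infinity is used.
  let f : FunField W := (y.1 ⟨(none : Option _), trivial⟩).1
  have hyf (z : Ctp W) : (y.1 ⟨z, trivial⟩).1 = f := congrArg Subtype.val (isLocConst_eq W y.2 _ _)
  have hsf (z : {z : Ctp W // z ∈ U}) : s.1 z = f :=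
    (congrArg Subtype.val (congrFun (congrArg Subtype.val hy) z)).symm.trans (hyf z.1)
  obtain ⟨t, ht, hpick⟩ := exists_denominators W hℓ hℓ' (V := {z : Pt W | z ∈ U}) (f := f)
    fun z hz => by
      rw [← hsf ⟨z, hz⟩]
      exact s.2.2 ⟨z, hz⟩
  choose pick hpick_mem hpick_ne hpick_inv using hpick
  let num (g : t) : (structureSheaf W).obj.obj (op D) :=
    ⟨fun _ => g.1 * f, isLocConst_const _, fun z => (ht g.1 g.2 z.1 (hD _ z.2)).2⟩
  let den (g : t) : (structureSheaf W).obj.obj (op D) :=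
    ⟨fun _ => g.1, isLocConst_const _, fun z => (ht g.1 g.2 z.1 (hD _ z.2)).1⟩
  -- Each point of `U` is assigned one denominator invertible at it. The family `inv g` holds the
  -- inverse of `g` at the points of `D` assigned to `g` and is `0` at the others, so a sum over `g`
  -- has at most one non-zero term at each point.
  let inv (g : t) : (completionSheaf W).obj.obj (op D) := completionMk D fun n i _ =>
    if h : ∃ hi : i.1 ∈ U, pick i.1 hi = g.1 then
      algebraMap (localRing W i.1) (completedLocalRing W i.1)
        ⟨(g.1)⁻¹, h.choose_spec ▸ hpick_inv i.1 h.choose⟩ else 0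
  -- Used twice, on `D`: with `den` it gives $e = \sum_g \mathrm{inv}_g\, g$, with `num` it gives $e
  -- x = \sum_g \mathrm{inv}_g\, g f$.
  have hsum (v : t → (structureSheaf W).obj.obj (op D)) (r : Γ (completionSheaf W))
      (hv : ∀ (n : ℕ+) (i : ExactOrder W n) (hi : i.1 ∈ U) (hi' : i.1 ∈ D),
        algebraMap (localRing W i.1) (completedLocalRing W i.1)
          ⟨(pick i.1 hi)⁻¹, hpick_inv i.1 hi⟩ *
          completionEval i hi' (((toCompletion W).hom.app (op D)).hom
            (v ⟨pick i.1 hi, hpick_mem i.1 hi⟩)) = completionEval (U := ⊤) i (mem_top W i.1) r) :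
      resTop (completionSheaf W) D (e * r) =
        ∑ g : t, inv g * ((toCompletion W).hom.app (op D)).hom (v g) := by
    refine completion_ext fun n i hi => ?_
    rw [completionEval_resTop, map_mul, he, completionEval_one_sub_gen, map_sum]
    simp only [map_mul]
    split_ifs with h
    · rw [Finset.sum_eq_single ⟨pick i.1 h, hpick_mem i.1 h⟩, one_mul, ← hv n i h hi,
        completionEval_completionMk, dif_pos ⟨h, rfl⟩]
      · intro g _ hg
        rw [completionEval_completionMk, dif_neg, zero_mul]
        rintro ⟨_, h'⟩
        exact hg (Subtype.ext h'.symm)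
      · exact fun h' => (h' (Finset.mem_univ _)).elim
    · rw [zero_mul]
      refine (Finset.sum_eq_zero fun g _ => ?_).symm
      rw [completionEval_completionMk, dif_neg, zero_mul]
      rintro ⟨h', _⟩
      exact h h'
  have h1 := hsum den 1 fun n i hi hi' => by
    rw [completionEval_toCompletion, ← map_mul, map_one]
    refine (congrArg _ (Subtype.ext ?_)).trans (map_one _)
    exact inv_mul_cancel₀ (hpick_ne _ hi)
  have h2 := hsum num x fun n i hi hi' => by
    rw [← completionEval_resTop W i hi, hx, completionEval_toCompletion,
      completionEval_toCompletion, ← map_mul]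
    refine congrArg _ (Subtype.ext ?_)
    change (pick i.1 hi)⁻¹ * (pick i.1 hi * f) = s.1 _
    rw [inv_mul_cancel_left₀ (hpick_ne _ hi), hsf]
  have hcomp (r : (structureSheaf W).obj.obj (op D)) :
      (α.hom.app (op D)).hom (((toCompletion W).hom.app (op D)).hom r) =
        (β.hom.app (op D)).hom (((toMeromorphic W).hom.app (op D)).hom r) :=
    congr(($(hαβ).hom.app (op D)).hom r)
  have hnum (g : t) : ((toMeromorphic W).hom.app (op D)).hom (num g) =
      ((toMeromorphic W).hom.app (op D)).hom (den g) * resTop (meromorphicSheaf W) D y :=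
    Subtype.ext (funext fun z => Subtype.ext (congrArg (g.1 * ·) (hyf z.1).symm))
  rw [mul_one] at h1
  -- Since `g` and `g * f` are regular on `D`, their images under `α` and `β` agree, so
  -- $\alpha(g)\beta(y) = \beta(gf) = \alpha(gf)$ termwise.
  rw [mul_sub, ← map_mul, map_sub, map_mul (resTop S D) (Γmap α e) (Γmap β y), ← app_resTop, ← app_resTop, ← app_resTop, h1, h2,
    map_sum, map_sum, Finset.sum_mul, sub_eq_zero]
  refine Finset.sum_congr rfl fun g _ => ?_
  rw [map_mul, map_mul, hcomp, hcomp, hnum, map_mul, mul_assoc]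

/-- The hypothesis of `isSplit_pushout` is an equality of global functions, hence local. Both sets
of the cover are complements of hyperplane sections consisting of torsion points. -/
lemma isSplit_tensorSheaf [CharZero k] : IsSplit (tensorSheaf W) := by
  refine isSplit_pushout (toCompletion W) (toMeromorphic W) (isSplit_completionSheaf W)
    (isSplit_constSheaf W _) fun S α β hαβ U s x y hx hy => ?_
  refine eq_of_resTop_eq
    (fun b : ULift.{u} Bool => bif b.down then affineOpen W else twoTorsionOpen W) ?_ ?_
  · rw [← affineOpen_sup_twoTorsionOpen W]
    refine le_antisymm (iSup_le ?_) (sup_le (le_iSup_of_le ⟨true⟩ le_rfl)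
      (le_iSup_of_le ⟨false⟩ le_rfl))
    rintro ⟨_ | _⟩
    · exact le_sup_right
    · exact le_sup_left
  · rintro ⟨_ | _⟩
    · refine (resTop_gen_mul_sub_eq_zero W hαβ hx hy (isHomogeneous_twoTorsionForm W) ?_
        fun _ h => h).trans (map_zero _).symm
      rw [formValue_twoTorsionForm]
      exact (map_ne_zero_iff _ (IsFractionRing.injective _ _)).2 (twoTorsionFun_ne_zero W)
    · refine (resTop_gen_mul_sub_eq_zero W hαβ hx hy (MvPolynomial.isHomogeneous_X k 2) ?_
        fun _ h => h).trans (map_zero _).symm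
      simp [formValue]

end Split

end TorsionCurve

/-! ### Fork-shaped diagrams and coreflections -/

section ForkEquivalence

variable {D₁ : Type u₁} {D₂ : Type u₂} {D₃ : Type u₃}
  [Category.{v₁} D₁] [Category.{v₂} D₂] [Category.{v₃} D₃]

namespace ForkDiagram

variable {L : D₂ ⥤ D₁} {R : D₂ ⥤ D₃}

/-- An isomorphism of diagrams, from isomorphisms at the three spots. -/
def isoMk {X Y : ForkDiagram L R} (n : X.N ≅ Y.N) (p : X.P ≅ Y.P) (v : X.V ≅ Y.V)
    (hk : X.k ≫ L.map p.hom = n.hom ≫ Y.k) (hm : X.m ≫ R.map p.hom = v.hom ≫ Y.m) : X ≅ Y where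
  hom := ⟨n.hom, p.hom, v.hom, hk, hm⟩
  inv := ⟨n.inv, p.inv, v.inv,
    by rw [Iso.eq_inv_comp, ← reassoc_of% hk, ← L.map_comp, p.hom_inv_id, L.map_id,
      Category.comp_id],
    by rw [Iso.eq_inv_comp, ← reassoc_of% hm, ← R.map_comp, p.hom_inv_id, R.map_id,
      Category.comp_id]⟩
  hom_inv_id := Hom.ext n.hom_inv_id p.hom_inv_id v.hom_inv_id
  inv_hom_id := Hom.ext n.inv_hom_id p.inv_hom_id v.inv_hom_id

end ForkDiagram

lemma isIso_homEquiv_symm_iff_of_iso {E : D₁ ⥤ D₂} {L : D₂ ⥤ D₁} (adj : E ⊣ L) {N N' : D₁}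
    {P P' : D₂} (n : N ≅ N') (p : P ≅ P') {k : N ⟶ L.obj P} {k' : N' ⟶ L.obj P'}
    (h : k ≫ L.map p.hom = n.hom ≫ k') :
    IsIso ((adj.homEquiv N P).symm k) ↔ IsIso ((adj.homEquiv N' P').symm k') := by
  have : (adj.homEquiv N P).symm k =
      E.map n.hom ≫ (adj.homEquiv N' P').symm k' ≫ p.inv := by
    rw [← adj.homEquiv_naturality_right_symm, ← adj.homEquiv_naturality_left_symm,
      ← reassoc_of% h, ← L.map_comp, p.hom_inv_id, L.map_id, Category.comp_id]
  rw [this, isIso_comp_left_iff, isIso_comp_right_iff]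

lemma comp_map_inv_comp_map_hom (L : D₂ ⥤ D₁) {N N' : D₁} {P P' : D₂} (n : N ⟶ N')
    (k : N' ⟶ L.obj P') (p : P ≅ P') : (n ≫ k ≫ L.map p.inv) ≫ L.map p.hom = n ≫ k := by
  rw [Category.assoc, Category.assoc, ← L.map_comp, p.inv_hom_id, L.map_id, Category.comp_id]

end ForkEquivalence

namespace TorsionCurve

section Equivalence

variable {k : Type u} [Field k] (W : WeierstrassCurve k) [W.IsElliptic]

lemma isCoreflection_completionSheaf :
    IsCoreflection (ΓMod (completionSheaf W)) fun F => F.IsQuasicoherent :=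
  (isSplit_completionSheaf W).isCoreflection_ΓMod

lemma isAC_of_iso {X Y : ModuleFork W} (e : X ≅ Y) (hY : isAC W Y) : isAC W X := by
  let n : X.N ≅ Y.N := ⟨e.hom.n, e.inv.n, congrArg ForkDiagram.Hom.n e.hom_inv_id,
    congrArg ForkDiagram.Hom.n e.inv_hom_id⟩
  let p : X.P ≅ Y.P := ⟨e.hom.p, e.inv.p, congrArg ForkDiagram.Hom.p e.hom_inv_id,
    congrArg ForkDiagram.Hom.p e.inv_hom_id⟩
  let v : X.V ≅ Y.V := ⟨e.hom.v, e.inv.v, congrArg ForkDiagram.Hom.v e.hom_inv_id,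
    congrArg ForkDiagram.Hom.v e.inv_hom_id⟩
  exact ⟨(isIso_homEquiv_symm_iff_of_iso _ n p e.hom.comm_k).2 hY.1,
    (isIso_homEquiv_symm_iff_of_iso _ v p e.hom.comm_m).2 hY.2⟩

variable [CharZero k]

lemma isCoreflection_tensorSheaf :
    IsCoreflection (ΓMod (tensorSheaf W)) fun F => F.IsQuasicoherent :=
  (isSplit_tensorSheaf W).isCoreflection_ΓMod

lemma isCoreflection_meromorphicSheaf :
    IsCoreflection (ΓMod (meromorphicSheaf W)) fun F => F.IsQuasicoherent :=
  (isSplit_constSheaf W _).isCoreflection_ΓMod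

/-- Global sections commute with restriction of scalars. -/
noncomputable def shRestrictΓModIso {X : TopCat.{u}}
    {A B : Sheaf (Opens.grothendieckTopology X) CommRingCat.{u}} (f : A ⟶ B) :
    shRestrict f ⋙ ΓMod A ≅ ΓMod B ⋙ ModuleCat.restrictScalars.{u} (Γmap f) :=
  Iso.refl _

/-- Restriction of scalars commutes with global sections, so each extension condition is a universal
arrow that can be tested on coreflections. -/
lemma isExtended_globalSections_iff {X : SheafFork W} (hN : X.N.IsQuasicoherent)
    (hP : X.P.IsQuasicoherent) (hV : X.V.IsQuasicoherent) :
    isAC W ((globalSections W).obj X) ↔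
      ForkDiagram.isExtended (shAdj (forkL W)) (shAdj (forkI W)) X :=
  and_congr
    (isIso_homEquiv_symm_iff_of_isCoreflection _ _ (shRestrictΓModIso (forkL W))
      (isCoreflection_completionSheaf W) (isCoreflection_tensorSheaf W) hN hP X.k).symm
    (isIso_homEquiv_symm_iff_of_isCoreflection _ _ (shRestrictΓModIso (forkI W))
      (isCoreflection_meromorphicSheaf W) (isCoreflection_tensorSheaf W) hV hP X.m).symm

/-- Lift the three modules separately, then the two maps. Their sources are quasi-coherent, which is
all the lifting needs. -/
lemma exists_iso_globalSections (Y : ModuleFork W) : ∃ X : SheafFork W,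
    (X.N.IsQuasicoherent ∧ X.P.IsQuasicoherent ∧ X.V.IsQuasicoherent) ∧
      Nonempty ((globalSections W).obj X ≅ Y) := by
  obtain ⟨N, hN, ⟨n⟩⟩ := (isCoreflection_completionSheaf W).exists_iso Y.N
  obtain ⟨P, hP, ⟨p⟩⟩ := (isCoreflection_tensorSheaf W).exists_iso Y.P
  obtain ⟨V, hV, ⟨v⟩⟩ := (isCoreflection_meromorphicSheaf W).exists_iso Y.V
  obtain ⟨k, hk⟩ := ((isCoreflection_completionSheaf W).bijective hN
    ((shRestrict (forkL W)).obj P)).2 (n.hom ≫ Y.k ≫ (ModuleCat.restrictScalars _).map p.inv)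
  obtain ⟨m, hm⟩ := ((isCoreflection_meromorphicSheaf W).bijective hV
    ((shRestrict (forkI W)).obj P)).2 (v.hom ≫ Y.m ≫ (ModuleCat.restrictScalars _).map p.inv)
  refine ⟨⟨N, P, V, k, m⟩, ⟨hN, hP, hV⟩, ⟨ForkDiagram.isoMk n p v ?_ ?_⟩⟩
  · refine (congrArg (· ≫ (ModuleCat.restrictScalars (Γmap (forkL W))).map p.hom) hk).trans ?_
    exact comp_map_inv_comp_map_hom _ n.hom Y.k p
  · refine (congrArg (· ≫ (ModuleCat.restrictScalars (Γmap (forkI W))).map p.hom) hm).trans ?_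
    exact comp_map_inv_comp_map_hom _ v.hom Y.m p

/-- Components lift uniquely, and the squares commute because maps out of `X.N` and `X.V` are
determined on global sections. -/
lemma globalSections_map_bijective {X : SheafFork W} (hN : X.N.IsQuasicoherent)
    (hP : X.P.IsQuasicoherent) (hV : X.V.IsQuasicoherent) (Y : SheafFork W) :
    Function.Bijective ((globalSections W).map : (X ⟶ Y) → _) := by
  have h₁ := isCoreflection_completionSheaf W
  have h₂ := isCoreflection_tensorSheaf W
  have h₃ := isCoreflection_meromorphicSheaf W
  refine ⟨fun f g hfg => ForkDiagram.Hom.ext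
    (h₁.hom_ext hN (congrArg ForkDiagram.Hom.n hfg))
    (h₂.hom_ext hP (congrArg ForkDiagram.Hom.p hfg))
    (h₃.hom_ext hV (congrArg ForkDiagram.Hom.v hfg)), fun g => ?_⟩
  obtain ⟨n, hn⟩ := (h₁.bijective hN Y.N).2 g.n
  obtain ⟨p, hp⟩ := (h₂.bijective hP Y.P).2 g.p
  obtain ⟨v, hv⟩ := (h₃.bijective hV Y.V).2 g.v
  refine ⟨⟨n, p, v, h₁.hom_ext hN ?_, h₃.hom_ext hV ?_⟩, ForkDiagram.Hom.ext hn hp hv⟩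
  · have := g.comm_k
    rw [← hn, ← hp] at this
    exact this
  · have := g.comm_m
    rw [← hv, ← hp] at this
    exact this

end Equivalence

end TorsionCurve

theorem mainTheorem7 {k : Type u} [Field k] [CharZero k] (W : WeierstrassCurve k) [W.IsElliptic] :
    Function.Bijective (constSection (TorsionCurve.Ctp W) (TorsionCurve.meromorphic W)) ∧
    ∃ h : ∀ X : (TorsionCurve.isAOC W).FullSubcategory,
        TorsionCurve.isAC W ((TorsionCurve.globalSections W).obj X.obj),
      ((TorsionCurve.isAC W).lift ((TorsionCurve.isAOC W).ι ⋙ TorsionCurve.globalSections W)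
        h).IsEquivalence := by
  refine ⟨TorsionCurve.constSection_bijective W _, fun X =>
    (TorsionCurve.isExtended_globalSections_iff W X.property.1.1 X.property.1.2.1
      X.property.1.2.2).2 X.property.2, ?_⟩
  have hbij (X Y : (TorsionCurve.isAOC W).FullSubcategory) :=
    TorsionCurve.globalSections_map_bijective W X.property.1.1 X.property.1.2.1
      X.property.1.2.2 Y.obj
  refine
    { faithful := ⟨fun {X Y} f g hfg => ?_⟩
      full := ⟨fun {X Y} g => ?_⟩
      essSurj := ⟨fun Y => ?_⟩ }
  · exact ObjectProperty.hom_ext _ ((hbij X Y).1 (congrArg (fun g => g.hom) hfg))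
  · obtain ⟨f, hf⟩ := (hbij X Y).2 g.hom
    exact ⟨ObjectProperty.homMk f, ObjectProperty.hom_ext _ hf⟩
  · obtain ⟨X, hX, ⟨e⟩⟩ := TorsionCurve.exists_iso_globalSections W Y.obj
    exact ⟨⟨X, hX, (TorsionCurve.isExtended_globalSections_iff W hX.1 hX.2.1 hX.2.2).1
      (TorsionCurve.isAC_of_iso W e Y.property)⟩, ⟨ObjectProperty.isoMk _ e⟩⟩
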